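/- **Setting.** Let $\mathbb R^n=\mathbb R^{n_1}\times\dots\times\mathbb R^{n_K}$ with the Euclidean norm, and let $\Omega=\Omega_1\times\dots\times\Omega_K$ with polyhedra $\Omega_k=\{v\in\mathbb R^{n_k}:\langle\omega_{k,i},v\rangle\le h_{k,i},\ i=1,\dots,m_k\}$. For $v\in\Omega_k$ let $\mathcal A_k(v)=\{i:\langle\omega_{k,i},v\rangle=h_{k,i}\}$, and for $z\in\Omega$ let $V(z)=\{v:\langle\omega_{k,i},v_k\rangle=0\ \forall k,\ \forall i\in\mathcal A_k(z_k)\}$, with orthogonal projection $\Pi_{V(z)}$. $P_S$ is the Euclidean projection onto $S$, and $\mathcal N_\Omega(x)=\{v:\langle v,y-x\rangle\le0\ \forall y\in\Omega\}$. Let $L$ be twice continuously differentiable on an open set containing $\Omega$, $g=\nabla L$, $H=\nabla^2L$; assume $g$ is uniformly continuous on $\Omega$ and $\|H(x)\|_2\le\hat B$ on $\Omega$ for some $\hat B>0$. Put $m^x(w)=L(x)+\langle g(x),w-x\rangle+\tfrac12\langle w-x,H(x)(w-x)\rangle$ (Newton model, $B=\nabla^2L$). **Algorithm (TRAP).** Fix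 $0<\sigma_1<\sigma_2<1<\sigma_3$, $0<\eta_1<\eta_2<1$, $\gamma_1,\nu_0\in(0,1)$, $\gamma_2>0$, $0<\nu_1<\nu_2$, $\nu_3,\nu_4,\nu_5>0$, $\gamma^*\in(0,\gamma_2)$ and $\theta\in[\tfrac12,1]$. For $0<\underline\sigma<\bar\sigma$, a run consists of $x^l,z^l,y^l,\alpha^l,\Delta^l,\sigma^l$ ($l\ge0$) with $x^0\in\Omega$, $\Delta^0>0$, $\sigma^l\in(\underline\sigma,\bar\sigma)$ such that for every $l$ the current iterate is not critical, $P_\Omega(x^l-g(x^l))\ne x^l$ (the run is infinite, termination tolerance $0$), and, dropping the index $l$ and writing $m=m^{x}$, the following three steps hold. 1. *Cauchy point.* For each $k$, put $m_k(v)=m(z_1,\dots,z_{k-1},v,x_{k+1},\dots,x_K)$ and $z_k(t)=P_{\Omega_k}(x_k-t\nabla m_k(x_k))$. Then $z_k=z_k(\alpha_k)$ with $\alpha_k>0$, $m_k(z_k)\le m_k(x_k)+\nu_0\langle\nabla m_k(x_k),z_k-x_k\rangle$, $\|z_k-x_k\|_\infty\le\nu_2\Delta$, and either $\alpha_k\in[\nu_4,\nu_5]$,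 or $\alpha_k\in[\nu_3\bar\alpha_k,\nu_5]$ for some $\bar\alpha_k>0$ with $m_k(z_k(\bar\alpha_k))>m_k(x_k)+\nu_0\langle\nabla m_k(x_k),z_k(\bar\alpha_k)-x_k\rangle$ or $\|z_k(\bar\alpha_k)-x_k\|_\infty\ge\nu_1\Delta$. 2. *Proximally regularised refinement.* $y\in\Omega$, $m(x)-m(y)\ge\gamma_1(m(x)-m(z))$, $\|y-x\|_\infty\le\gamma_2\Delta$, $\mathcal A_k(z_k)\subseteq\mathcal A_k(y_k)$ for all $k$. Moreover, with $g_\sigma=g(x)-\sigma(z-x)$ and $H_\sigma=H(x)+\theta\sigma I$, the step $p=y-x$ is obtained after finitely many iterations of the safeguarded conjugate gradient method on the subspace $V(z)$ for the quadratic $\langle g_\sigma,p\rangle+\tfrac12\langle p,H_\sigma p\rangle$ with feasible set $F=\{p:x+p\in\Omega,\ \|p\|_\infty\le\gamma_2\Delta,\ \mathcal A_k(z_k)\subseteq\mathcal A_k(x_k+p_k)\ \forall k\}$, started at $z-x\in F$. That is, $p$ is a conjugate gradient iterate, all iterates so far lying in $F$ and all directions used having positive curvature; or, if the next direction has nonpositive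 curvature or the full conjugate gradient step leaves $F$, $p$ is the point where that direction leaves $F$. (For $\theta=1$ the quadratic is, up to a constant, $\langle g(x),p\rangle+\tfrac12\langle p,H(x)p\rangle+\tfrac\sigma2\|x+p-z\|_2^2$.) 3. *Update.* With $\rho=\frac{L(x)-L(y)}{m(x)-m(y)}$: if $\rho<\eta_1$ then $x^+=x$, $\Delta^+\in[\sigma_1\Delta,\sigma_2\Delta]$; if $\rho\in[\eta_1,\eta_2]$ then $x^+=y$, $\Delta^+\in[\sigma_1\Delta,\sigma_3\Delta]$; if $\rho>\eta_2$ then $x^+=y$, $\Delta^+\in[\Delta,\sigma_3\Delta]$. *Inexact Newton condition* with forcing terms $\xi^l\in(0,1)$: for every $l$, with $p^l=y^l-x^l$, if $\|p^l\|_\infty\le\gamma^*\Delta^l$ and $\mathcal A_k(x^l_k)=\mathcal A_k(x^l_k+p^l_k)$ for all $k$, then $$\bigl\|\Pi_{V(z^l)}\bigl(g_{\sigma^l}(x^l)+H_{\sigma^l}(x^l)p^l\bigr)\bigr\|_2\le\xi^l\,\bigl\|\Pi_{V(z^l)}g(x^l)\bigr\|_2 .$$ **Theorem (local linear convergence).**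 Let $x^*\in\Omega$ be non-degenerate, $-g(x^*)\in\operatorname{ri}\mathcal N_\Omega(x^*)$, and suppose that for some $\kappa>0$, $\langle v,H(x^*)v\rangle\ge\kappa\|v\|_2^2$ for all $v\in\mathcal N_\Omega(x^*)^\perp$. Consider runs of TRAP that have $x^*$ as a limit point of $\{x^l\}$, for which $L$ is bounded below on $\{x\in\Omega:L(x)\le L(x^0)\}$ and the inexact Newton condition holds, and put $\xi^*=\limsup_l\xi^l$. (i) There are $\sigma_0>0$ and $\xi_0\in(0,1)$ such that, whenever $0<\underline\sigma<\bar\sigma<\sigma_0$, every such run with $\xi^*<\xi_0$ converges to $x^*$ Q-linearly: $x^l\to x^*$ and, for some $\varrho\in(0,1)$, $\|x^{l+1}-x^*\|_2\le\varrho\|x^l-x^*\|_2$ for all large $l$. (ii) For every $\varrho\in(0,1)$ there is $\sigma_0>0$ such that, whenever $0<\underline\sigma<\bar\sigma<\sigma_0$, every such run with $\xi^*=0$ satisfies $x^l\to x^*$ and $\|x^{l+1}-x^*\|_2\le\varrho\|x^l-x^*\|_2$ for all large $l$. -/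

import Mathlib

open Set Filter Topology

/-- `ℝⁿ = ℝ^{n_1} × ⋯ × ℝ^{n_K}` with the Euclidean norm; `x k` is the `k`-th block of `x`. -/
abbrev BlockSpace {K : ℕ} (n : Fin K → ℕ) : Type :=
  PiLp 2 (fun k : Fin K => EuclideanSpace ℝ (Fin (n k)))

/-- The norm `‖v‖_∞` of a single block. -/
noncomputable def blockSupNorm {d : ℕ} (v : EuclideanSpace ℝ (Fin d)) : ℝ :=
  ‖(WithLp.ofLp v : Fin d → ℝ)‖

/-- The norm `‖p‖_∞` of a full vector (the maximum over all blocks of all coordinates). -/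
noncomputable def fullSupNorm {K : ℕ} {n : Fin K → ℕ} (p : BlockSpace n) : ℝ :=
  ‖(fun k => (WithLp.ofLp (p k) : Fin (n k) → ℝ) : ∀ k : Fin K, Fin (n k) → ℝ)‖

/-- `v = P_S(u)`: the point `v` is a nearest point of `S` to `u`
(it is unique when `S` is convex). -/
def IsProj {E : Type*} [NormedAddCommGroup E] (S : Set E) (u v : E) : Prop :=
  v ∈ S ∧ ∀ w ∈ S, ‖u - v‖ ≤ ‖u - w‖

/-- The normal cone to `S` at a point `x` of `S`. -/
def normalCone {E : Type*} [NormedAddCommGroup E] [InnerProductSpace ℝ E]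
    (S : Set E) (x : E) : Set E :=
  {v | ∀ y ∈ S, inner ℝ v (y - x) ≤ 0}

/-- The data of one polyhedron in every block of variables. -/
structure BlockPolyhedron {K : ℕ} (n : Fin K → ℕ) where
  /-- number of inequalities in block `k` -/
  m : Fin K → ℕ
  /-- normals -/
  ω : ∀ k : Fin K, Fin (m k) → EuclideanSpace ℝ (Fin (n k))
  /-- right-hand sides -/
  h : ∀ k : Fin K, Fin (m k) → ℝ

namespace BlockPolyhedron

variable {K : ℕ} {n : Fin K → ℕ}

/-- `Ω_k`. -/
def block (Ω : BlockPolyhedron n) (k : Fin K) : Set (EuclideanSpace ℝ (Fin (n k))) :=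
  {v | ∀ i, inner ℝ (Ω.ω k i) v ≤ Ω.h k i}

/-- `Ω = Ω_1 × ⋯ × Ω_K`. -/
def carrier (Ω : BlockPolyhedron n) : Set (BlockSpace n) :=
  {x | ∀ k, x k ∈ Ω.block k}

/-- The active set `𝒜_{Ω_k}(v)`. -/
def active (Ω : BlockPolyhedron n) (k : Fin K) (v : EuclideanSpace ℝ (Fin (n k))) :
    Set (Fin (Ω.m k)) :=
  {i | inner ℝ (Ω.ω k i) v = Ω.h k i}

/-- The subspace `V(z)` of the directions orthogonal to all normals of constraints
active at `z`. -/
def freeSpace (Ω : BlockPolyhedron n) (z : BlockSpace n) : Submodule ℝ (BlockSpace n) where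
  carrier := {v | ∀ k, ∀ i ∈ Ω.active k (z k), inner ℝ (Ω.ω k i) (v k) = 0}
  zero_mem' := by
    intro k i _
    simp
  add_mem' := by
    intro a b ha hb k i hi
    simp [inner_add_right, ha k i hi, hb k i hi]
  smul_mem' := by
    intro c a ha k i hi
    simp [inner_smul_right, ha k i hi]

end BlockPolyhedron

/-- The Hessian of `L`, as the derivative of the gradient. -/
noncomputable def hessian {E : Type*} [NormedAddCommGroup E] [InnerProductSpace ℝ E]
    [CompleteSpace E] (L : E → ℝ) (x : E) : E →L[ℝ] E :=
  fderiv ℝ (gradient L) x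

/-- The Newton model `m` of `L` around `x` (that is, `B = ∇²L`), evaluated at `w`. -/
noncomputable def model {E : Type*} [NormedAddCommGroup E] [InnerProductSpace ℝ E]
    [CompleteSpace E] (L : E → ℝ) (x w : E) : ℝ :=
  L x + inner ℝ (gradient L x) (w - x) + (1 / 2) * inner ℝ (w - x) (hessian L x (w - x))

/-- The gradient of the model around `x`, evaluated at `w` (the Hessian being symmetric). -/
noncomputable def modelGrad {E : Type*} [NormedAddCommGroup E] [InnerProductSpace ℝ E]
    [CompleteSpace E] (L : E → ℝ) (x w : E) : E :=
  gradient L x + hessian L x (w - x)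

/-- The parameters of the trust region method. -/
structure TrapParams where
  σ₁ : ℝ
  σ₂ : ℝ
  σ₃ : ℝ
  η₁ : ℝ
  η₂ : ℝ
  γ₁ : ℝ
  γ₂ : ℝ
  ν₀ : ℝ
  ν₁ : ℝ
  ν₂ : ℝ
  ν₃ : ℝ
  ν₄ : ℝ
  ν₅ : ℝ
  σ₁_pos : 0 < σ₁
  σ₁_lt : σ₁ < σ₂
  σ₂_lt : σ₂ < 1
  σ₃_gt : 1 < σ₃
  η₁_pos : 0 < η₁
  η₁_lt : η₁ < η₂
  η₂_lt : η₂ < 1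
  γ₁_mem : γ₁ ∈ Ioo (0 : ℝ) 1
  γ₂_pos : 0 < γ₂
  ν₀_mem : ν₀ ∈ Ioo (0 : ℝ) 1
  ν₁_pos : 0 < ν₁
  ν₁_lt : ν₁ < ν₂
  ν₃_pos : 0 < ν₃
  ν₄_pos : 0 < ν₄
  ν₅_pos : 0 < ν₅

section Algorithm

variable {K : ℕ} {n : Fin K → ℕ}

/-- The point `(z_1, …, z_{k-1}, v, x_{k+1}, …, x_K)`. -/
def sweepPoint (x z : BlockSpace n) (k : Fin K) (v : EuclideanSpace ℝ (Fin (n k))) :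
    BlockSpace n :=
  WithLp.toLp 2 (Function.update (fun j : Fin K => if j < k then z j else x j) k v)

/-- The block model `m_k(v) = m(z_1, …, z_{k-1}, v, x_{k+1}, …, x_K)`. -/
noncomputable def blockModel (L : BlockSpace n → ℝ) (x z : BlockSpace n) (k : Fin K)
    (v : EuclideanSpace ℝ (Fin (n k))) : ℝ :=
  model L x (sweepPoint x z k v)

/-- The partial gradient `∇_k m(z_1, …, z_{k-1}, x_k, x_{k+1}, …, x_K)`. -/
noncomputable def blockModelGrad (L : BlockSpace n → ℝ) (x z : BlockSpace n) (k : Fin K) :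
    EuclideanSpace ℝ (Fin (n k)) :=
  modelGrad L x (sweepPoint x z k (x k)) k

/-- Sufficient decrease of the block model at `v`. -/
def SuffDecrease (prm : TrapParams) (L : BlockSpace n → ℝ) (x z : BlockSpace n) (k : Fin K)
    (v : EuclideanSpace ℝ (Fin (n k))) : Prop :=
  blockModel L x z k v ≤ blockModel L x z k (x k)
    + prm.ν₀ * inner ℝ (blockModelGrad L x z k) (v - x k)

/-- `z` is the Cauchy point obtained from `x` by one sweep of alternating gradient projections
with step-sizes `α_k` that are neither too large nor too small. -/
structure IsCauchyPoint (prm : TrapParams) (Ω : BlockPolyhedron n) (L : BlockSpace n → ℝ)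
    (Δ : ℝ) (x : BlockSpace n) (α : Fin K → ℝ) (z : BlockSpace n) : Prop where
  pos : ∀ k, 0 < α k
  proj : ∀ k, IsProj (Ω.block k) (x k - α k • blockModelGrad L x z k) (z k)
  decrease : ∀ k, SuffDecrease prm L x z k (z k)
  inside : ∀ k, blockSupNorm (z k - x k) ≤ prm.ν₂ * Δ
  large : ∀ k, α k ∈ Icc prm.ν₄ prm.ν₅ ∨
    ∃ αbar : ℝ, 0 < αbar ∧ α k ∈ Icc (prm.ν₃ * αbar) prm.ν₅ ∧
      ∃ w, IsProj (Ω.block k) (x k - αbar • blockModelGrad L x z k) w ∧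
        (¬ SuffDecrease prm L x z k w ∨ prm.ν₁ * Δ ≤ blockSupNorm (w - x k))

/-- The regularised gradient `g_σ(x) = g(x) - σ (z - x)`. -/
noncomputable def regGrad (L : BlockSpace n → ℝ) (σ : ℝ) (x z : BlockSpace n) : BlockSpace n :=
  gradient L x - σ • (z - x)

/-- The regularised Hessian `H_σ(x) = H(x) + θ σ I`. -/
noncomputable def regHess (L : BlockSpace n → ℝ) (θ σ : ℝ) (x : BlockSpace n) :
    BlockSpace n →L[ℝ] BlockSpace n :=
  hessian L x + (θ * σ) • ContinuousLinearMap.id ℝ (BlockSpace n)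

/-- The feasible steps `p` of the refinement subproblem. -/
def refineSet (Ω : BlockPolyhedron n) (r : ℝ) (x z : BlockSpace n) : Set (BlockSpace n) :=
  {p | x + p ∈ Ω.carrier ∧ fullSupNorm p ≤ r ∧
    ∀ k, Ω.active k (z k) ⊆ Ω.active k ((x + p) k)}

end Algorithm

/-- The states `(p, r, d)` (iterate, residual, search direction) that the conjugate gradient
method reaches when it is applied on the subspace `V` to the quadratic `⟨c, p⟩ + ⟨p, A p⟩ / 2`
from the feasible starting point `p₀`, all its steps staying in the feasible set `F` and all its
search directions having positive curvature. -/
inductive CGState {E : Type*} [NormedAddCommGroup E] [InnerProductSpace ℝ E]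
    [FiniteDimensional ℝ E] (F : Set E) (V : Submodule ℝ E) (c : E) (A : E →L[ℝ] E) (p₀ : E) :
    E → E → E → Prop
  | init (h₀ : p₀ ∈ F) :
      CGState F V c A p₀ p₀ (-V.starProjection (c + A p₀)) (-V.starProjection (c + A p₀))
  | step (p r d r' : E) (a : ℝ) (hs : CGState F V c A p₀ p r d)
      (hcurv : 0 < inner ℝ d (A d)) (ha : a = ‖r‖ ^ 2 / inner ℝ d (A d))
      (hF : p + a • d ∈ F) (hr : r' = r - a • V.starProjection (A d)) :
      CGState F V c A p₀ (p + a • d) r' (r' + (‖r'‖ ^ 2 / ‖r‖ ^ 2) • d)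

/-- `p` is an output of the safeguarded conjugate gradient method: either a conjugate gradient
iterate, or the point where the boundary of the feasible set `F` is hit along a search direction
of nonpositive curvature or along which the full conjugate gradient step leaves `F`. -/
def IsSCGOutput {E : Type*} [NormedAddCommGroup E] [InnerProductSpace ℝ E]
    [FiniteDimensional ℝ E] (F : Set E) (V : Submodule ℝ E) (c : E) (A : E →L[ℝ] E)
    (p₀ p : E) : Prop :=
  (∃ r d, CGState F V c A p₀ p r d) ∨
  (∃ q r d, ∃ a : ℝ, CGState F V c A p₀ q r d ∧
    (inner ℝ d (A d) ≤ 0 ∨ q + (‖r‖ ^ 2 / inner ℝ d (A d)) • d ∉ F) ∧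
    0 ≤ a ∧ q + a • d ∈ F ∧ (∀ b, a < b → q + b • d ∉ F) ∧ p = q + a • d)

section Run

variable {K : ℕ} {n : Fin K → ℕ}

/-- The refinement step: `y` satisfies the requirements of the trust region method, and `y - x`
is produced by the safeguarded conjugate gradient method, started at the Cauchy point `z`, on the
proximally regularised subproblem. -/
structure IsRefinement (prm : TrapParams) (Ω : BlockPolyhedron n) (L : BlockSpace n → ℝ)
    (θ σ Δ : ℝ) (x z y : BlockSpace n) : Prop where
  mem : y ∈ Ω.carrier
  decrease : prm.γ₁ * (model L x x - model L x z) ≤ model L x x - model L x y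
  inside : fullSupNorm (y - x) ≤ prm.γ₂ * Δ
  active : ∀ k, Ω.active k (z k) ⊆ Ω.active k (y k)
  scg : IsSCGOutput (refineSet Ω (prm.γ₂ * Δ) x z) (Ω.freeSpace z)
    (regGrad L σ x z) (regHess L θ σ x) (z - x) (y - x)

/-- The ratio `ρ` of the actual to the predicted decrease. -/
noncomputable def trustRatio (L : BlockSpace n → ℝ) (x y : BlockSpace n) : ℝ :=
  (L x - L y) / (model L x x - model L x y)

/-- The trust region update from `(x, Δ)` to `(x', Δ')`. -/
def TrustUpdate (prm : TrapParams) (L : BlockSpace n → ℝ) (x y : BlockSpace n) (Δ : ℝ)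
    (x' : BlockSpace n) (Δ' : ℝ) : Prop :=
  (trustRatio L x y < prm.η₁ → x' = x ∧ Δ' ∈ Icc (prm.σ₁ * Δ) (prm.σ₂ * Δ)) ∧
  (trustRatio L x y ∈ Icc prm.η₁ prm.η₂ → x' = y ∧ Δ' ∈ Icc (prm.σ₁ * Δ) (prm.σ₃ * Δ)) ∧
  (prm.η₂ < trustRatio L x y → x' = y ∧ Δ' ∈ Icc Δ (prm.σ₃ * Δ))

/-- An infinite run of the method (with tolerance zero): iterates `x`, step-sizes `α`, Cauchy
points `z`, refined points `y`, radii `Δ`, regularisation coefficients `σ`. -/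
structure IsTrapRun (prm : TrapParams) (Ω : BlockPolyhedron n) (L : BlockSpace n → ℝ)
    (θ σlow σbar : ℝ) (x z y : ℕ → BlockSpace n) (α : ℕ → Fin K → ℝ) (Δ σ : ℕ → ℝ) : Prop where
  start : x 0 ∈ Ω.carrier
  radius : 0 < Δ 0
  running : ∀ l, ¬ IsProj Ω.carrier (x l - gradient L (x l)) (x l)
  cauchy : ∀ l, IsCauchyPoint prm Ω L (Δ l) (x l) (α l) (z l)
  reg : ∀ l, σ l ∈ Ioo σlow σbar
  refinement : ∀ l, IsRefinement prm Ω L θ (σ l) (Δ l) (x l) (z l) (y l)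
  update : ∀ l, TrustUpdate prm L (x l) (y l) (Δ l) (x (l + 1)) (Δ (l + 1))

/-- The inexact Newton condition with forcing terms `ξ`: it is required of those steps
`p = y - x` that are well inside the trust region and do not change the active set. The orthogonal
projection onto `V(z)` is `Z Zᵀ`, where the columns of `Z` are an orthonormal basis of `V(z)`. -/
def InexactNewton (Ω : BlockPolyhedron n) (L : BlockSpace n → ℝ) (θ γstar : ℝ)
    (x z y : ℕ → BlockSpace n) (Δ σ ξ : ℕ → ℝ) : Prop :=
  ∀ l, ξ l ∈ Ioo (0 : ℝ) 1 ∧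
    (fullSupNorm (y l - x l) ≤ γstar * Δ l →
      (∀ k, Ω.active k (x l k) = Ω.active k (y l k)) →
      ‖(Ω.freeSpace (z l)).starProjection
          (regGrad L (σ l) (x l) (z l) + regHess L θ (σ l) (x l) (y l - x l))‖
        ≤ ξ l * ‖(Ω.freeSpace (z l)).starProjection (gradient L (x l))‖)

end Run

/-- `x*` is a non-degenerate critical point: `-∇L(x*)` is in the relative interior of the normal
cone. -/
def IsNondegenerate {E : Type*} [NormedAddCommGroup E] [InnerProductSpace ℝ E]
    [CompleteSpace E] (S : Set E) (L : E → ℝ) (xstar : E) : Prop :=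
  xstar ∈ S ∧ -gradient L xstar ∈ intrinsicInterior ℝ (normalCone S xstar)

/-- Convergence of `x` to `x*` at the Q-linear rate `ϱ`. -/
def QLinearRate {E : Type*} [NormedAddCommGroup E] (x : ℕ → E) (xstar : E) (ϱ : ℝ) : Prop :=
  Tendsto x atTop (𝓝 xstar) ∧
    ∀ᶠ l in atTop, ‖x (l + 1) - xstar‖ ≤ ϱ * ‖x l - xstar‖

/-!
Around a nondegenerate point `x*` satisfying the second-order condition everything is controlled by
the distance `e = ‖x - x*‖`. Nondegeneracy is used as strict complementarity: since `-∇L(x*)` stays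
in the normal cone when a small multiple of an active normal is subtracted, the slack of every
active constraint is bounded by the linear functional `⟨∇L(x*), · - x*⟩`
(`BlockPolyhedron.exists_slack_le_of_nondegenerate`). Together with an error bound for linear
equations this makes the functional sharp: it grows at least linearly with the distance to the face
of `x*`. These facts are collected in `LocalStructure`.

Three consequences follow for one iteration. Since a Cauchy step-size is bounded above and `x*` is
stationary, the Cauchy point satisfies `‖z - x‖ ≤ C e`; if `z` misses the face of `x*`, sharpness
forces the step-size to be `O(e)`, which only the trust region can cause, so that `Δ ≤ C e`
(`LocalStructure.exists_identification`). The safeguarded conjugate gradient method never increases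
its quadratic (`IsSCGOutput.descent`); hence `‖y - x‖ ≤ C e`, by strong convexity on the face in the
first case and by the trust region in the second (`LocalStructure.exists_step_bound`). Finally, the
Cauchy decrease and the proximal term give a model decrease of at least a multiple of `‖y - x‖²`
(`exists_sq_norm_le_model_sub`).

Now `L` decreases along a run and has quadratic growth at `x*`, and steps are `O(e)`, so a run that
clusters at `x*` is captured by it (`tendsto_of_mapClusterPt_of_growth`). The second-order expansion
of `L` has error `o(‖y - x‖²)`, which the model decrease dominates: eventually all steps are
accepted and the radius no longer shrinks (`IsTrapRun.eventually_accept`). As `Δ ≤ C e → 0` has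
become impossible, all iterates eventually lie on the face of `x*`, and the inexact Newton condition
applies. Coercivity of the Hessian on the face then bounds `κ ‖x⁺ - x*‖` by
`(ξ B + o(1) + 2 σ C) e` (`LocalStructure.newton_error`), which gives any prescribed rate when `ξ`
and `σ` are small. The constant `C` does not depend on `σ ≤ 1`, so the bound on `σ` depends only on
the rate and the problem.
-/

/-! ### Projections onto convex sets and projected gradient steps -/

section Projection

variable {E : Type*} [NormedAddCommGroup E] [InnerProductSpace ℝ E] {S : Set E}

theorem IsProj.inner_le_zero (hS : Convex ℝ S) {u v w : E} (h : IsProj S u v) (hw : w ∈ S) :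
    inner ℝ (u - v) (w - v) ≤ 0 := by
  refine (norm_eq_iInf_iff_real_inner_le_zero hS h.1).1 (le_antisymm ?_ ?_) w hw
  · have : Nonempty S := ⟨⟨v, h.1⟩⟩
    exact le_ciInf fun w => h.2 w w.2
  · exact ciInf_le ⟨0, by rintro _ ⟨w, rfl⟩; positivity⟩ (⟨v, h.1⟩ : S)

theorem isProj_of_inner_le_zero {u v : E} (hv : v ∈ S)
    (h : ∀ w ∈ S, inner ℝ (u - v) (w - v) ≤ 0) : IsProj S u v := by
  refine ⟨hv, fun w hw => ?_⟩
  have h1 : ‖u - w‖ ^ 2 = ‖u - v‖ ^ 2 - 2 * inner ℝ (u - v) (w - v) + ‖w - v‖ ^ 2 := by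
    rw [← norm_sub_sq_real, sub_sub_sub_cancel_right]
  have h2 := h w hw
  exact (sq_le_sq₀ (norm_nonneg _) (norm_nonneg _)).1 (by nlinarith [sq_nonneg ‖w - v‖])

/-- A projected gradient step of length `α` from a feasible point is a descent direction. -/
theorem IsProj.sq_norm_sub_le (hS : Convex ℝ S) {x G z : E} {α : ℝ} (hx : x ∈ S)
    (h : IsProj S (x - α • G) z) : ‖z - x‖ ^ 2 ≤ -(α * inner ℝ G (z - x)) := by
  have h1 := h.inner_le_zero hS hx
  have h2 : inner ℝ (x - α • G - z) (x - z) = ‖z - x‖ ^ 2 + α * inner ℝ G (z - x) := by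
    rw [← real_inner_self_eq_norm_sq, show x - α • G - z = -(z - x) - α • G by abel,
      show x - z = -(z - x) by abel, inner_sub_left, inner_neg_neg, inner_smul_left,
      inner_neg_right]
    simp
  linarith

/-- If `x*` is stationary for the field `g*`, a projected gradient step cannot move away from `x*`
by more than the perturbations of the base point and of the gradient allow. -/
theorem IsProj.norm_sub_le (hS : Convex ℝ S) {x xs G gs z : E} {α : ℝ} (hα : 0 ≤ α) (hxs : xs ∈ S)
    (hgs : ∀ v ∈ S, 0 ≤ inner ℝ gs (v - xs)) (h : IsProj S (x - α • G) z) :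
    ‖z - xs‖ ≤ ‖x - xs‖ + α * ‖G - gs‖ := by
  have h1 := h.inner_le_zero hS hxs
  have h2 := hgs z h.1
  have h3 : inner ℝ (x - α • G - z) (xs - z) = ‖z - xs‖ ^ 2 - inner ℝ (x - xs) (z - xs)
      + α * inner ℝ (G - gs) (z - xs) + α * inner ℝ gs (z - xs) := by
    rw [← real_inner_self_eq_norm_sq,
      show x - α • G - z = (x - xs) - (z - xs) - α • (G - gs) - α • gs by module,
      show xs - z = -(z - xs) by abel]
    simp only [inner_sub_left, inner_neg_right, inner_smul_left, conj_trivial]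
    ring
  have h4 := real_inner_le_norm (x - xs) (z - xs)
  have h5 := abs_le.1 (abs_real_inner_le_norm (G - gs) (z - xs))
  have h6 : ‖z - xs‖ * ‖z - xs‖ ≤ (‖x - xs‖ + α * ‖G - gs‖) * ‖z - xs‖ := by
    nlinarith [mul_nonneg hα h2]
  rcases (norm_nonneg (z - xs)).eq_or_lt with h0 | h0
  · rw [← h0]; positivity
  · exact le_of_mul_le_mul_right h6 h0

/-- If `g*` is sharp in the direction from the face point `x* + a` to `z ≠ x* + a`, then `z` can be
the result of a projected gradient step only if that step is short. -/
theorem IsProj.stepsize_mul_le (hS : Convex ℝ S) {x xs a G gs z : E} {α c : ℝ} (hα : 0 ≤ α)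
    (ha : xs + a ∈ S) (hgs : inner ℝ gs a = 0)
    (hc : c * ‖z - xs - a‖ ≤ inner ℝ gs (z - xs)) (hne : z - xs - a ≠ 0)
    (h : IsProj S (x - α • G) z) : α * (c - ‖G - gs‖) ≤ ‖x - z‖ := by
  have h1 := h.inner_le_zero hS ha
  set b := z - xs - a with hb
  have h2 : inner ℝ (x - α • G - z) (xs + a - z) = -inner ℝ (x - z) b
      + α * inner ℝ (G - gs) b + α * inner ℝ gs (z - xs) := by
    have : inner ℝ gs (z - xs) = inner ℝ gs b := by rw [hb, inner_sub_right _ _ a, hgs, sub_zero]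
    rw [this, show x - α • G - z = (x - z) - α • (G - gs) - α • gs by module,
      show xs + a - z = -b by rw [hb]; abel]
    simp only [inner_sub_left, inner_neg_right, inner_smul_left, conj_trivial]
    ring
  have h4 := real_inner_le_norm (x - z) b
  have h5 := (abs_le.1 (abs_real_inner_le_norm (G - gs) b)).1
  have h6 : (α * (c - ‖G - gs‖)) * ‖b‖ ≤ ‖x - z‖ * ‖b‖ := by
    nlinarith [mul_le_mul_of_nonneg_left hc hα, mul_le_mul_of_nonneg_left h5 hα]
  exact le_of_mul_le_mul_right h6 (norm_pos_iff.2 hne)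

end Projection

/-! ### The safeguarded conjugate gradient method -/

section ConjugateGradient

variable {E : Type*} [NormedAddCommGroup E] [InnerProductSpace ℝ E]

/-- The quadratic `⟨c, p⟩ + ⟨p, A p⟩ / 2`. -/
noncomputable def quadForm (c : E) (A : E →L[ℝ] E) (p : E) : ℝ :=
  inner ℝ c p + 1 / 2 * inner ℝ p (A p)

theorem quadForm_add {A : E →L[ℝ] E} (hA : ∀ u v, inner ℝ (A u) v = inner ℝ u (A v)) (c p v : E) :
    quadForm c A (p + v) = quadForm c A p + inner ℝ (c + A p) v + 1 / 2 * inner ℝ v (A v) := by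
  have h1 : inner ℝ v (A p) = inner ℝ p (A v) := by rw [real_inner_comm, hA]
  simp only [quadForm, map_add, inner_add_left, inner_add_right, h1, hA p v]
  ring

variable [FiniteDimensional ℝ E] {F : Set E} {V : Submodule ℝ E} {c : E} {A : E →L[ℝ] E} {p₀ : E}

/-- The invariants of the conjugate gradient method that do not involve conjugacy: feasibility of
the iterate, confinement to `p₀ + V`, the residual being minus the projected gradient, and the
identity `⟨r, d⟩ = ‖r‖²`, which makes every search direction a descent direction. -/
theorem CGState.invariant {p r d : E} (h : CGState F V c A p₀ p r d) :
    p ∈ F ∧ p - p₀ ∈ V ∧ r = -V.starProjection (c + A p) ∧ d ∈ V ∧ inner ℝ r d = ‖r‖ ^ 2 := by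
  induction h with
  | init h₀ =>
    refine ⟨h₀, by simp, rfl, V.neg_mem (V.starProjection_apply_mem _), ?_⟩
    rw [real_inner_self_eq_norm_sq]
  | step p r d r' a hs hcurv ha hF hr ih =>
    obtain ⟨-, h2, h3, h4, h5⟩ := ih
    have hr' : r' = -V.starProjection (c + A (p + a • d)) := by
      rw [hr, h3]; simp only [map_add, map_smul]; abel
    have hV : r' ∈ V := hr' ▸ V.neg_mem (V.starProjection_apply_mem _)
    have h0 : inner ℝ r' d = 0 := by
      rw [hr, inner_sub_left, inner_smul_left, Submodule.inner_starProjection_left_eq_right,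
        Submodule.starProjection_eq_self_iff.2 h4, h5, ha, real_inner_comm d (A d)]
      simp only [conj_trivial]
      rw [div_mul_cancel₀ _ hcurv.ne', sub_self]
    refine ⟨hF, ?_, hr', V.add_mem hV (V.smul_mem _ h4), ?_⟩
    · rw [add_sub_right_comm]; exact V.add_mem h2 (V.smul_mem _ h4)
    · rw [inner_add_right, inner_smul_right, h0, mul_zero, add_zero, real_inner_self_eq_norm_sq]

/-- The value of the quadratic along a conjugate gradient direction. -/
theorem CGState.quadForm_line (hA : ∀ u v, inner ℝ (A u) v = inner ℝ u (A v)) {p r d : E}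
    (h : CGState F V c A p₀ p r d) (a : ℝ) :
    quadForm c A (p + a • d)
      = quadForm c A p - a * ‖r‖ ^ 2 + a ^ 2 / 2 * inner ℝ d (A d) := by
  obtain ⟨-, -, h3, h4, h5⟩ := h.invariant
  have h6 : inner ℝ (c + A p) d = -‖r‖ ^ 2 := by
    rw [← h5, h3, inner_neg_left, neg_neg, Submodule.inner_starProjection_left_eq_right,
      Submodule.starProjection_eq_self_iff.2 h4]
  rw [quadForm_add hA, inner_smul_right, h6, map_smul, inner_smul_left, inner_smul_right]
  simp only [conj_trivial]
  ring

theorem CGState.quadForm_le (hA : ∀ u v, inner ℝ (A u) v = inner ℝ u (A v)) {p r d : E}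
    (h : CGState F V c A p₀ p r d) : quadForm c A p ≤ quadForm c A p₀ := by
  induction h with
  | init h₀ => exact le_rfl
  | step p r d r' a hs hcurv ha hF hr ih =>
    refine le_trans ?_ ih
    rw [hs.quadForm_line hA]
    have h1 : a * inner ℝ d (A d) = ‖r‖ ^ 2 := by rw [ha, div_mul_cancel₀ _ hcurv.ne']
    have h2 : 0 ≤ a := by rw [ha]; positivity
    nlinarith [mul_nonneg h2 (sq_nonneg ‖r‖)]

/-- An output of the safeguarded method stays in `p₀ + V` and does not increase the quadratic.
When the method stops at the boundary along a direction of positive curvature, convexity of `F`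
ensures that the boundary is met before the minimiser on that line. -/
theorem IsSCGOutput.descent (hF : Convex ℝ F)
    (hA : ∀ u v, inner ℝ (A u) v = inner ℝ u (A v)) {p : E} (h : IsSCGOutput F V c A p₀ p) :
    p - p₀ ∈ V ∧ quadForm c A p ≤ quadForm c A p₀ := by
  rcases h with ⟨r, d, h⟩ | ⟨q, r, d, a, h, hor, ha, haF, -, rfl⟩
  · exact ⟨h.invariant.2.1, h.quadForm_le hA⟩
  obtain ⟨hqF, h2, -, h4, -⟩ := h.invariant
  refine ⟨?_, le_trans ?_ (h.quadForm_le hA)⟩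
  · rw [add_sub_right_comm]; exact V.add_mem h2 (V.smul_mem _ h4)
  rw [h.quadForm_line hA]
  rcases le_or_gt (inner ℝ d (A d)) 0 with hc | hc
  · nlinarith [mul_nonneg ha (sq_nonneg ‖r‖), mul_nonneg (sq_nonneg a) (neg_nonneg.2 hc)]
  have hout := hor.resolve_left hc.not_ge
  set t := ‖r‖ ^ 2 / inner ℝ d (A d) with ht
  have h1 : t * inner ℝ d (A d) = ‖r‖ ^ 2 := by rw [ht, div_mul_cancel₀ _ hc.ne']
  have ht0 : 0 ≤ t := by rw [ht]; positivity
  have hat : a ≤ t := by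
    by_contra! hlt
    have ha0 : 0 < a := ht0.trans_lt hlt
    apply hout
    have := hF hqF haF (a := 1 - t / a) (b := t / a)
      (by rw [sub_nonneg, div_le_one ha0]; exact hlt.le) (by positivity) (by ring)
    convert this using 1
    rw [smul_add, smul_smul, div_mul_cancel₀ _ ha0.ne']
    module
  nlinarith [mul_nonneg (mul_nonneg ha (sub_nonneg.2 hat)) hc.le, mul_nonneg ha (sq_nonneg ‖r‖)]

end ConjugateGradient

/-! ### Second-order expansions -/

section Smooth

variable {E : Type*} [NormedAddCommGroup E] [InnerProductSpace ℝ E] [CompleteSpace E]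
  {L : E → ℝ} {x : E}

theorem gradient_eq_comp_fderiv (L : E → ℝ) :
    gradient L = (InnerProductSpace.toDual ℝ E).symm ∘ fderiv ℝ L := rfl

theorem ContDiffAt.gradient_one (h : ContDiffAt ℝ 2 L x) : ContDiffAt ℝ 1 (gradient L) x := by
  have h1 : ContDiffAt ℝ 1 (fderiv ℝ L) x := h.fderiv_right (by norm_num)
  rw [gradient_eq_comp_fderiv]
  exact (InnerProductSpace.toDual ℝ E).symm.toContinuousLinearEquiv.contDiff.contDiffAt.comp x h1

theorem ContDiffAt.hasFDerivAt_gradient (h : ContDiffAt ℝ 2 L x) :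
    HasFDerivAt (gradient L) (hessian L x) x :=
  (h.gradient_one.differentiableAt one_ne_zero).hasFDerivAt

theorem ContDiffAt.continuousAt_hessian (h : ContDiffAt ℝ 2 L x) :
    ContinuousAt (hessian L) x :=
  (h.gradient_one.fderiv_right (m := 0) (by norm_num)).continuousAt

theorem inner_hessian_comm (h : ContDiffAt ℝ 2 L x) (u v : E) :
    inner ℝ (hessian L x u) v = inner ℝ u (hessian L x v) := by
  have h1 : DifferentiableAt ℝ (fderiv ℝ L) x :=
    (h.fderiv_right (m := 1) (by norm_num)).differentiableAt one_ne_zero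
  have h2 : ∀ u v, inner ℝ (hessian L x u) v = fderiv ℝ (fderiv ℝ L) x u v := by
    intro u v
    have h3 := h.hasFDerivAt_gradient.inner ℝ (hasFDerivAt_const v x)
    have h4 := h1.hasFDerivAt.clm_apply (hasFDerivAt_const v x)
    have h5 : (fun w => inner ℝ (gradient L w) v) = fun w => fderiv ℝ L w v :=
      funext fun w => InnerProductSpace.toDual_symm_apply
    have h6 := DFunLike.congr_fun (HasFDerivAt.unique h3 (h5 ▸ h4)) u
    simpa [fderivInnerCLM_apply] using h6
  rw [h2, real_inner_comm, h2]
  exact h.isSymmSndFDerivAt (by simp) u v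

theorem hasFDerivAt_model (h : ContDiffAt ℝ 2 L x) (w : E) :
    HasFDerivAt (model L x) (InnerProductSpace.toDual ℝ E (modelGrad L x w)) w := by
  have h1 : HasFDerivAt (fun w => w - x) (ContinuousLinearMap.id ℝ E) w :=
    (hasFDerivAt_id w).sub_const x
  have h2 := (hessian L x).hasFDerivAt.comp w h1
  have h3 := (((hasFDerivAt_const (gradient L x) w).inner ℝ h1).const_add (L x)).add
    ((h1.inner ℝ h2).const_mul (1 / 2))
  refine h3.congr_fderiv ?_
  ext v
  have h4 : inner ℝ (w - x) (hessian L x v) = inner ℝ (hessian L x (w - x)) v :=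
    (inner_hessian_comm h _ _).symm
  have h5 : inner ℝ v (hessian L x (w - x)) = inner ℝ (hessian L x (w - x)) v :=
    real_inner_comm _ _
  simp only [modelGrad, InnerProductSpace.toDual_apply_apply, inner_add_left]
  simp [fderivInnerCLM_apply, h4]
  simp only [← map_sub, h5]
  ring

theorem ContDiffAt.hasFDerivAt_toDual_gradient (h : ContDiffAt ℝ 2 L x) :
    HasFDerivAt L (InnerProductSpace.toDual ℝ E (gradient L x)) x :=
  (h.differentiableAt two_ne_zero).hasGradientAt.hasFDerivAt

theorem norm_gradient_sub_le {S : Set E} (hS : Convex ℝ S) (hL : ∀ x ∈ S, ContDiffAt ℝ 2 L x)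
    {B : ℝ} (hB : ∀ x ∈ S, ‖hessian L x‖ ≤ B) {x y : E} (hx : x ∈ S) (hy : y ∈ S) :
    ‖gradient L y - gradient L x‖ ≤ B * ‖y - x‖ :=
  hS.norm_image_sub_le_of_norm_hasFDerivWithin_le
    (fun w hw => (hL w hw).hasFDerivAt_gradient.hasFDerivWithinAt) hB hx hy

/-- Second-order expansions that are uniform near `x*`: the Hessian, the gradient and the function
are approximated by the model around any nearby point, with arbitrarily small constants. -/
theorem exists_uniform_expansion {S : Set E} (hS : Convex ℝ S)
    (hL : ∀ x ∈ S, ContDiffAt ℝ 2 L x) {xs : E} (hxs : xs ∈ S) {ε : ℝ} (hε : 0 < ε) :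
    ∃ δ > 0, ∀ x ∈ S, ‖x - xs‖ < δ → ‖hessian L x - hessian L xs‖ ≤ ε ∧
      ∀ y ∈ S, ‖y - xs‖ < δ →
        ‖gradient L y - gradient L x - hessian L x (y - x)‖ ≤ ε * ‖y - x‖ ∧
        |L y - model L x y| ≤ ε * ‖y - x‖ ^ 2 := by
  obtain ⟨δ, hδ, hδH⟩ := Metric.continuousAt_iff.1 (hL xs hxs).continuousAt_hessian (ε / 2)
    (half_pos hε)
  simp only [dist_eq_norm] at hδH
  refine ⟨δ, hδ, fun x hx hxδ => ⟨(hδH hxδ).le.trans (by linarith), fun y hy hyδ => ?_⟩⟩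
  set T := S ∩ Metric.ball xs δ with hT
  have hTc : Convex ℝ T := hS.inter (convex_ball _ _)
  have hmem : ∀ w ∈ S, ‖w - xs‖ < δ → w ∈ T := fun w hw h => ⟨hw, by rwa [mem_ball_iff_norm]⟩
  have hgrad : ∀ w ∈ T,
      ‖gradient L w - gradient L x - hessian L x (w - x)‖ ≤ ε * ‖w - x‖ := by
    intro w hw
    have h1 := hTc.norm_image_sub_le_of_norm_hasFDerivWithin_le (C := ε)
      (f := fun w => gradient L w - hessian L x w)
      (f' := fun w => hessian L w - hessian L x)
      (fun v hv => ((hL v hv.1).hasFDerivAt_gradient.sub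
        (hessian L x).hasFDerivAt).hasFDerivWithinAt)
      (fun v hv => ?_) (hmem x hx hxδ) hw
    · refine le_trans (le_of_eq ?_) h1
      rw [map_sub]; congr 1; abel
    · have h2 := hδH (x := v) (by rw [← dist_eq_norm]; exact hv.2)
      have h3 := hδH hxδ
      calc ‖hessian L v - hessian L x‖
          = ‖(hessian L v - hessian L xs) - (hessian L x - hessian L xs)‖ := by congr 1; abel
        _ ≤ _ := (norm_sub_le _ _).trans (by linarith)
  refine ⟨hgrad y (hmem y hy hyδ), ?_⟩
  -- apply the mean value inequality on the segment, where the gradient bound is uniform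
  have hseg : segment ℝ x y ⊆ T := hTc.segment_subset (hmem x hx hxδ) (hmem y hy hyδ)
  have h1 := (convex_segment x y).norm_image_sub_le_of_norm_hasFDerivWithin_le
    (C := ε * ‖y - x‖) (f := fun w => L w - model L x w)
    (f' := fun w => InnerProductSpace.toDual ℝ E (gradient L w)
      - InnerProductSpace.toDual ℝ E (modelGrad L x w))
    (fun v hv => ((hL v (hseg hv).1).hasFDerivAt_toDual_gradient.sub
        (hasFDerivAt_model (hL x hx) v)).hasFDerivWithinAt)
    (fun v hv => ?_) (left_mem_segment ℝ x y) (right_mem_segment ℝ x y)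
  · have h2 : L x - model L x x = 0 := by simp [model]
    simp only [h2, sub_zero, Real.norm_eq_abs] at h1
    calc |L y - model L x y| ≤ ε * ‖y - x‖ * ‖y - x‖ := h1
      _ = _ := by ring
  · rw [← map_sub, LinearIsometryEquiv.norm_map, modelGrad, ← sub_sub]
    refine (hgrad v (hseg hv)).trans (mul_le_mul_of_nonneg_left ?_ hε.le)
    obtain ⟨t, ht, rfl⟩ := (segment_eq_image' ℝ x y ▸ hv :
      v ∈ (fun t : ℝ => x + t • (y - x)) '' Icc 0 1)
    rw [add_sub_cancel_left, norm_smul, Real.norm_of_nonneg ht.1]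
    exact mul_le_of_le_one_left (norm_nonneg _) ht.2

end Smooth

/-! ### Polyhedra and nondegeneracy -/

/-- Finitely many conditions that hold for all small positive constants hold for a common one. -/
theorem exists_pos_forall_of_finite {ι : Type*} [Finite ι] {p : ι → ℝ → Prop}
    (h : ∀ i, ∃ c > 0, ∀ c' ∈ Ioc 0 c, p i c') : ∃ c > 0, ∀ i, p i c := by
  have h1 : ∀ᶠ c : ℝ in 𝓝[>] 0, ∀ i, p i c := by
    refine eventually_all.2 fun i => ?_
    obtain ⟨c, hc, hp⟩ := h i
    filter_upwards [Ioc_mem_nhdsGT hc] with c' hc' using hp c' hc'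
  obtain ⟨c, h2, h3⟩ := (h1.and self_mem_nhdsWithin).exists
  exact ⟨c, h3, h2⟩

/-- Hoffman's error bound for a homogeneous system of linear equations. -/
theorem exists_norm_sub_le_of_abs_inner_le {E : Type*} [NormedAddCommGroup E]
    [InnerProductSpace ℝ E] [FiniteDimensional ℝ E] {ι : Type*} [Finite ι] (ω : ι → E)
    (A : Set ι) : ∃ C > 0, ∀ d : E, ∃ a : E, (∀ i ∈ A, inner ℝ (ω i) a = 0) ∧ ‖a‖ ≤ ‖d‖ ∧
      ∀ M, 0 ≤ M → (∀ i ∈ A, |inner ℝ (ω i) d| ≤ M) → ‖d - a‖ ≤ C * M := by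
  have := Fintype.ofFinite A
  let T : E →ₗ[ℝ] (A → ℝ) := LinearMap.pi fun i => (innerSL ℝ (ω i) : E →ₗ[ℝ] ℝ)
  have hT : ∀ d i, T d i = inner ℝ (ω i) d := fun d i => rfl
  let V := LinearMap.ker T
  obtain ⟨C, hC, hanti⟩ := (T.domRestrict Vᗮ).exists_antilipschitzWith (by
    rw [LinearMap.ker_eq_bot']
    rintro ⟨b, hb⟩ h
    have hbV : b ∈ V := h
    have := V.inf_orthogonal_eq_bot ▸ (Submodule.mem_inf.2 ⟨hbV, hb⟩)
    simpa using this)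
  refine ⟨C, hC, fun d => ⟨V.starProjection d, fun i hi => ?_,
    V.norm_starProjection_apply_le d, fun M hM hd => ?_⟩⟩
  · have : T (V.starProjection d) = 0 := V.starProjection_apply_mem d
    rw [← hT _ ⟨i, hi⟩, this]; rfl
  · have hb : d - V.starProjection d ∈ Vᗮ := V.sub_starProjection_mem_orthogonal d
    have h1 : ‖(⟨_, hb⟩ : Vᗮ)‖ ≤ C * ‖T.domRestrict Vᗮ ⟨_, hb⟩‖ := by
      simpa [norm_sub_rev] using hanti.le_mul_norm_sub ⟨_, hb⟩ 0
    have h2 : T (V.starProjection d) = 0 := V.starProjection_apply_mem d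
    rw [LinearMap.domRestrict_apply, map_sub, h2, sub_zero] at h1
    refine h1.trans (mul_le_mul_of_nonneg_left ?_ C.2)
    exact (pi_norm_le_iff_of_nonneg hM).2 fun i => hd i i.2

/-- Segments ending in a relative interior point of a set can be prolonged inside the set. -/
theorem exists_add_smul_sub_mem_of_mem_intrinsicInterior {E : Type*} [NormedAddCommGroup E]
    [NormedSpace ℝ E] {N : Set E} {u w : E} (hu : u ∈ intrinsicInterior ℝ N) (hw : w ∈ N) :
    ∃ δ : ℝ, 0 < δ ∧ u + δ • (u - w) ∈ N := by
  obtain ⟨u', hu', rfl⟩ := mem_intrinsicInterior.1 hu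
  have hmem : ∀ t : ℝ, AffineMap.lineMap (u' : E) w t ∈ affineSpan ℝ N := fun t =>
    AffineMap.lineMap_mem t u'.2 (subset_affineSpan ℝ N hw)
  have hcont : Continuous fun t : ℝ => (⟨AffineMap.lineMap (u' : E) w (-t), hmem _⟩ :
      affineSpan ℝ N) := by
    refine Continuous.subtype_mk ?_ _
    exact AffineMap.lineMap_continuous.comp continuous_neg
  have h1 : ∀ᶠ t : ℝ in 𝓝 0, (⟨AffineMap.lineMap (u' : E) w (-t), hmem _⟩ : affineSpan ℝ N) ∈
      (Subtype.val ⁻¹' N : Set (affineSpan ℝ N)) := by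
    refine hcont.continuousAt.eventually_mem ?_
    rw [← mem_interior_iff_mem_nhds]
    convert hu'
    simp
  obtain ⟨t, ht, h2⟩ := ((h1.filter_mono nhdsWithin_le_nhds).and
    (self_mem_nhdsWithin (s := Ioi 0))).exists
  refine ⟨t, h2, ?_⟩
  have h3 : AffineMap.lineMap (u' : E) w (-t) ∈ N := ht
  rw [AffineMap.lineMap_apply] at h3
  convert h3 using 1
  simp only [vsub_eq_sub, vadd_eq_add]
  module

section Blocks

variable {K : ℕ} {n : Fin K → ℕ}

theorem inner_single_left {ι : Type*} [Fintype ι] [DecidableEq ι] {β : ι → Type*}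
    [∀ i, NormedAddCommGroup (β i)] [∀ i, InnerProductSpace ℝ (β i)] (i : ι) (a : β i)
    (v : PiLp 2 β) : inner ℝ (PiLp.single 2 i a) v = inner ℝ a (v i) := by
  rw [PiLp.inner_apply, Finset.sum_eq_single i]
  · simp
  · intro j _ hj; simp [hj]
  · simp

theorem PiLp.norm_le_sum_norm {ι : Type*} [Fintype ι] {β : ι → Type*}
    [∀ i, NormedAddCommGroup (β i)] (v : PiLp 2 β) : ‖v‖ ≤ ∑ i, ‖v i‖ := by
  refine (sq_le_sq₀ (norm_nonneg _) (Finset.sum_nonneg fun _ _ => norm_nonneg _)).1 ?_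
  rw [PiLp.norm_sq_eq_of_L2]
  exact Finset.sum_sq_le_sq_sum_of_nonneg fun _ _ => norm_nonneg _

theorem blockSupNorm_le_norm {d : ℕ} (v : EuclideanSpace ℝ (Fin d)) : blockSupNorm v ≤ ‖v‖ :=
  (pi_norm_le_iff_of_nonneg (norm_nonneg _)).2 fun i => PiLp.norm_apply_le v i

theorem fullSupNorm_le_norm (p : BlockSpace n) : fullSupNorm p ≤ ‖p‖ :=
  (pi_norm_le_iff_of_nonneg (norm_nonneg _)).2 fun k =>
    (blockSupNorm_le_norm (p k)).trans (PiLp.norm_apply_le p k)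

theorem norm_le_mul_fullSupNorm (p : BlockSpace n) :
    ‖p‖ ≤ (∑ k, (n k : ℝ)) * fullSupNorm p := by
  refine (PiLp.norm_le_sum_norm p).trans ?_
  rw [Finset.sum_mul]
  refine Finset.sum_le_sum fun k _ => (PiLp.norm_le_sum_norm (p k)).trans ?_
  have h1 : ∀ i ∈ Finset.univ, ‖p k i‖ ≤ fullSupNorm p := fun i _ =>
    (norm_le_pi_norm (WithLp.ofLp (p k) : Fin (n k) → ℝ) i).trans
      (norm_le_pi_norm (fun k => (WithLp.ofLp (p k) : Fin (n k) → ℝ)) k)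
  simpa using Finset.sum_le_card_nsmul _ _ _ h1

theorem fullSupNorm_convex (r : ℝ) : Convex ℝ {p : BlockSpace n | fullSupNorm p ≤ r} := by
  intro p hp q hq a b ha hb hab
  have h1 : fullSupNorm (a • p + b • q) ≤ a * fullSupNorm p + b * fullSupNorm q := by
    have := norm_add_le (a • fun k => (WithLp.ofLp (p k) : Fin (n k) → ℝ))
      (b • fun k => (WithLp.ofLp (q k) : Fin (n k) → ℝ))
    rwa [norm_smul, norm_smul, Real.norm_of_nonneg ha, Real.norm_of_nonneg hb] at this
  calc fullSupNorm (a • p + b • q) ≤ a * fullSupNorm p + b * fullSupNorm q := h1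
    _ ≤ a * r + b * r := by gcongr <;> assumption
    _ = r := by rw [← add_mul, hab, one_mul]

theorem exists_pos_norm_smul_lt {E : Type*} [NormedAddCommGroup E] [NormedSpace ℝ E] (v : E)
    {r : ℝ} (hr : 0 < r) : ∃ t : ℝ, 0 < t ∧ ‖t • v‖ < r := by
  refine ⟨r / (‖v‖ + 1), by positivity, ?_⟩
  rw [norm_smul, Real.norm_of_nonneg (by positivity), div_mul_eq_mul_div,
    div_lt_iff₀ (by positivity)]
  nlinarith [norm_nonneg v]

namespace BlockPolyhedron

variable (Ω : BlockPolyhedron n)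

theorem convex_block (k : Fin K) : Convex ℝ (Ω.block k) := by
  intro u hu v hv a b ha hb hab i
  rw [inner_add_right, inner_smul_right, inner_smul_right]
  calc a * inner ℝ (Ω.ω k i) u + b * inner ℝ (Ω.ω k i) v ≤ a * Ω.h k i + b * Ω.h k i := by
        gcongr
        · exact hu i
        · exact hv i
    _ = Ω.h k i := by rw [← add_mul, hab, one_mul]

theorem convex_carrier : Convex ℝ Ω.carrier := fun _ hu _ hv _ _ ha hb hab k =>
  Ω.convex_block k (hu k) (hv k) ha hb hab

theorem convex_refineSet (r : ℝ) (x z : BlockSpace n) : Convex ℝ (refineSet Ω r x z) := by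
  intro p hp q hq a b ha hb hab
  have hsplit : x + (a • p + b • q) = a • (x + p) + b • (x + q) := by
    have : x = a • x + b • x := by rw [← add_smul, hab, one_smul]
    nth_rewrite 1 [this]
    simp only [smul_add]; abel
  refine ⟨?_, fullSupNorm_convex r hp.2.1 hq.2.1 ha hb hab, fun k i hi => ?_⟩
  · rw [hsplit]; exact Ω.convex_carrier hp.1 hq.1 ha hb hab
  · have h1 : inner ℝ (Ω.ω k i) ((x + p) k) = Ω.h k i := hp.2.2 k hi
    have h2 : inner ℝ (Ω.ω k i) ((x + q) k) = Ω.h k i := hq.2.2 k hi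
    show inner ℝ (Ω.ω k i) ((x + (a • p + b • q)) k) = Ω.h k i
    rw [hsplit, PiLp.add_apply, PiLp.smul_apply, PiLp.smul_apply, inner_add_right,
      inner_smul_right, inner_smul_right, h1, h2, ← add_mul, hab, one_mul]

variable {Ω}

theorem add_single_mem {xs : BlockSpace n} (hxs : xs ∈ Ω.carrier) (k : Fin K)
    {v : EuclideanSpace ℝ (Fin (n k))} (hv : v ∈ Ω.block k) :
    xs + PiLp.single 2 k (v - xs k) ∈ Ω.carrier := by
  intro j
  rcases eq_or_ne j k with rfl | hj
  · simpa using hv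
  · simpa [hj] using hxs j

/-- Constraints inactive at a point remain inactive nearby. -/
theorem exists_inner_lt_of_norm_sub_lt {xs : BlockSpace n} (hxs : xs ∈ Ω.carrier) :
    ∃ r > 0, ∀ (k : Fin K) (v : EuclideanSpace ℝ (Fin (n k))), ‖v - xs k‖ < r →
      ∀ i ∉ Ω.active k (xs k), inner ℝ (Ω.ω k i) v < Ω.h k i := by
  obtain ⟨r, hr, h⟩ := exists_pos_forall_of_finite (ι := Σ k, Fin (Ω.m k))
    (p := fun ki r => ∀ v, ‖v - xs ki.1‖ < r → ki.2 ∉ Ω.active ki.1 (xs ki.1) →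
      inner ℝ (Ω.ω ki.1 ki.2) v < Ω.h ki.1 ki.2) (by
    rintro ⟨k, i⟩
    by_cases hi : i ∈ Ω.active k (xs k)
    · exact ⟨1, one_pos, fun _ _ _ _ h => absurd hi h⟩
    have h1 : inner ℝ (Ω.ω k i) (xs k) < Ω.h k i := (hxs k i).lt_of_ne hi
    have h2 : ContinuousAt (fun v => inner ℝ (Ω.ω k i) v) (xs k) := by fun_prop
    obtain ⟨r, hr, h3⟩ := Metric.eventually_nhds_iff.1 (h2.eventually_lt_const h1)
    refine ⟨r, hr, fun r' hr' v hv _ => h3 ?_⟩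
    rw [dist_eq_norm]
    exact hv.trans_le hr'.2)
  exact ⟨r, hr, fun k v hv i hi => h ⟨k, i⟩ v hv hi⟩

/-- Nondegeneracy is strict complementarity: the slack of every constraint active at `x*` is
controlled by the linear functional `∇L(x*)`. -/
theorem exists_slack_le_of_nondegenerate {L : BlockSpace n → ℝ} {xs : BlockSpace n}
    (h : IsNondegenerate Ω.carrier L xs) (k : Fin K) :
    ∃ ε > 0, ∀ i ∈ Ω.active k (xs k), ∀ v ∈ Ω.block k,
      ε * (Ω.h k i - inner ℝ (Ω.ω k i) v) ≤ inner ℝ (gradient L xs k) (v - xs k) := by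
  refine (exists_pos_forall_of_finite (ι := Ω.active k (xs k)) (p := fun i ε => ∀ v ∈ Ω.block k,
    ε * (Ω.h k i - inner ℝ (Ω.ω k i) v) ≤ inner ℝ (gradient L xs k) (v - xs k)) ?_).imp
    fun ε h => ⟨h.1, fun i hi => h.2 ⟨i, hi⟩⟩
  rintro ⟨i, hi⟩
  have hi' : inner ℝ (Ω.ω k i) (xs k) = Ω.h k i := hi
  have hω : PiLp.single 2 k (Ω.ω k i) ∈ normalCone Ω.carrier xs := by
    intro y hy
    rw [inner_single_left, PiLp.sub_apply, inner_sub_right, hi']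
    linarith [hy k i]
  obtain ⟨δ, hδ, hN⟩ := exists_add_smul_sub_mem_of_mem_intrinsicInterior h.2 hω
  refine ⟨δ / (1 + δ), by positivity, fun ε hε v hv => ?_⟩
  have hslack : 0 ≤ Ω.h k i - inner ℝ (Ω.ω k i) v := sub_nonneg.2 (hv i)
  have h1 := hN _ (add_single_mem h.1 k hv)
  rw [add_sub_cancel_left, real_inner_comm, inner_single_left] at h1
  simp only [PiLp.add_apply, PiLp.neg_apply, PiLp.smul_apply, PiLp.sub_apply,
    PiLp.single_eq_same, inner_add_right, inner_neg_right, inner_smul_right, inner_sub_right]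
    at h1
  rw [real_inner_comm (gradient L xs k), real_inner_comm (Ω.ω k i), inner_sub_right (Ω.ω k i),
    hi'] at h1
  refine (mul_le_mul_of_nonneg_right hε.2 hslack).trans ?_
  rw [div_mul_eq_mul_div, div_le_iff₀ (by positivity)]
  linarith

end BlockPolyhedron

/-- The local structure at a nondegenerate point `x*` satisfying the second-order condition:
`L` is smooth on `Ω` with Hessian bounded by `B`; constraints inactive at `x*` stay inactive within
distance `r`; in every block the gradient at `x*` vanishes along the critical face and grows at
least linearly, at rate `c`, with the distance to its tangent space; the Hessian at `x*` is
`κ`-coercive on that tangent space. -/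
structure LocalStructure (Ω : BlockPolyhedron n) (L : BlockSpace n → ℝ) (xs : BlockSpace n)
    (B c r κ : ℝ) : Prop where
  smooth : ∀ x ∈ Ω.carrier, ContDiffAt ℝ 2 L x
  B_pos : 0 < B
  bound : ∀ x ∈ Ω.carrier, ‖hessian L x‖ ≤ B
  mem : xs ∈ Ω.carrier
  r_pos : 0 < r
  inactive : ∀ (k : Fin K) (v : EuclideanSpace ℝ (Fin (n k))), ‖v - xs k‖ < r →
      ∀ i ∉ Ω.active k (xs k), inner ℝ (Ω.ω k i) v < Ω.h k i
  c_pos : 0 < c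
  sharp : ∀ k, ∀ v ∈ Ω.block k, ∃ a, (∀ i ∈ Ω.active k (xs k), inner ℝ (Ω.ω k i) a = 0) ∧
      ‖a‖ ≤ ‖v - xs k‖ ∧ c * ‖v - xs k - a‖ ≤ inner ℝ (gradient L xs k) (v - xs k)
  κ_pos : 0 < κ
  coercive : ∀ v ∈ Ω.freeSpace xs, κ * ‖v‖ ^ 2 ≤ inner ℝ v (hessian L xs v)

namespace LocalStructure

variable {Ω : BlockPolyhedron n} {L : BlockSpace n → ℝ} {xs : BlockSpace n} {B c r κ : ℝ}

theorem inner_nonneg (D : LocalStructure Ω L xs B c r κ) (k : Fin K) :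
    ∀ v ∈ Ω.block k, 0 ≤ inner ℝ (gradient L xs k) (v - xs k) := by
  intro v hv
  obtain ⟨a, -, -, h⟩ := D.sharp k v hv
  exact (mul_nonneg D.c_pos.le (norm_nonneg _)).trans h

theorem active_subset (D : LocalStructure Ω L xs B c r κ) {k : Fin K}
    {v : EuclideanSpace ℝ (Fin (n k))} (hv : ‖v - xs k‖ < r) :
    Ω.active k v ⊆ Ω.active k (xs k) := by
  intro i hi
  by_contra h
  exact (D.inactive k v hv i h).ne hi

theorem add_mem_block (D : LocalStructure Ω L xs B c r κ) {k : Fin K}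
    {a : EuclideanSpace ℝ (Fin (n k))} (ha : ‖a‖ < r)
    (h : ∀ i ∈ Ω.active k (xs k), inner ℝ (Ω.ω k i) a = 0) : xs k + a ∈ Ω.block k := by
  intro i
  by_cases hi : i ∈ Ω.active k (xs k)
  · rw [inner_add_right, h i hi, add_zero]; exact D.mem k i
  · exact (D.inactive k _ (by simpa using ha) i hi).le

theorem inner_gradient_eq_zero (D : LocalStructure Ω L xs B c r κ) {k : Fin K}
    {a : EuclideanSpace ℝ (Fin (n k))}
    (h : ∀ i ∈ Ω.active k (xs k), inner ℝ (Ω.ω k i) a = 0) :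
    inner ℝ (gradient L xs k) a = 0 := by
  obtain ⟨t, ht, hta⟩ := exists_pos_norm_smul_lt a D.r_pos
  have h1 := D.inner_nonneg k _ (D.add_mem_block (a := t • a) hta
    fun i hi => by rw [inner_smul_right, h i hi, mul_zero])
  have h2 := D.inner_nonneg k _ (D.add_mem_block (a := -(t • a)) (by rwa [norm_neg])
    fun i hi => by rw [inner_neg_right, inner_smul_right, h i hi, mul_zero, neg_zero])
  rw [add_sub_cancel_left, inner_smul_right] at h1
  rw [add_sub_cancel_left, inner_neg_right, inner_smul_right] at h2
  have h3 : t * inner ℝ (gradient L xs k) a = 0 := by linarith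
  exact (mul_eq_zero.1 h3).resolve_left ht.ne'

theorem inner_gradient_freeSpace (D : LocalStructure Ω L xs B c r κ) {v : BlockSpace n}
    (hv : v ∈ Ω.freeSpace xs) : inner ℝ (gradient L xs) v = 0 := by
  rw [PiLp.inner_apply]
  exact Finset.sum_eq_zero fun k _ => D.inner_gradient_eq_zero (hv k)

theorem norm_gradient_sub_le (D : LocalStructure Ω L xs B c r κ) {x y : BlockSpace n}
    (hx : x ∈ Ω.carrier) (hy : y ∈ Ω.carrier) :
    ‖gradient L y - gradient L x‖ ≤ B * ‖y - x‖ :=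
  _root_.norm_gradient_sub_le Ω.convex_carrier D.smooth D.bound hx hy

theorem abs_inner_hessian_le (D : LocalStructure Ω L xs B c r κ) {x : BlockSpace n}
    (hx : x ∈ Ω.carrier) (u v : BlockSpace n) :
    |inner ℝ u (hessian L x v)| ≤ B * (‖u‖ * ‖v‖) := by
  refine (abs_real_inner_le_norm _ _).trans ?_
  have := (hessian L x).le_of_opNorm_le (D.bound x hx) v
  nlinarith [norm_nonneg u]

end LocalStructure

/-- The second-order condition on the orthogonal complement of the normal cone applies to the
tangent space of the face of `x*`, because that space is orthogonal to the cone. -/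
theorem exists_localStructure {Ω : BlockPolyhedron n} {L : BlockSpace n → ℝ}
    (hsmooth : ∃ U : Set (BlockSpace n), IsOpen U ∧ Ω.carrier ⊆ U ∧ ContDiffOn ℝ 2 L U)
    (hbound : ∃ Bhat : ℝ, 0 < Bhat ∧ ∀ x ∈ Ω.carrier, ‖hessian L x‖ ≤ Bhat)
    {xs : BlockSpace n} (hnondeg : IsNondegenerate Ω.carrier L xs) {κ : ℝ} (hκ : 0 < κ)
    (hsecond : ∀ v : BlockSpace n,
      (∀ w ∈ normalCone Ω.carrier xs, inner ℝ w v = 0) →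
        κ * ‖v‖ ^ 2 ≤ inner ℝ v (hessian L xs v)) :
    ∃ B c r, LocalStructure Ω L xs B c r κ := by
  obtain ⟨U, hU, hΩU, hL⟩ := hsmooth
  obtain ⟨B, hB, hbd⟩ := hbound
  have hxs := hnondeg.1
  obtain ⟨r, hr, hin⟩ := BlockPolyhedron.exists_inner_lt_of_norm_sub_lt hxs
  have hN : -gradient L xs ∈ normalCone Ω.carrier xs := intrinsicInterior_subset hnondeg.2
  obtain ⟨c, hc, hsharp⟩ := exists_pos_forall_of_finite (ι := Fin K) (p := fun k c =>
    ∀ v ∈ Ω.block k, ∃ a, (∀ i ∈ Ω.active k (xs k), inner ℝ (Ω.ω k i) a = 0) ∧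
      ‖a‖ ≤ ‖v - xs k‖ ∧ c * ‖v - xs k - a‖ ≤ inner ℝ (gradient L xs k) (v - xs k)) (by
    intro k
    obtain ⟨C, hC, hH⟩ := exists_norm_sub_le_of_abs_inner_le (Ω.ω k) (Ω.active k (xs k))
    obtain ⟨ε, hε, hslack⟩ := BlockPolyhedron.exists_slack_le_of_nondegenerate hnondeg k
    refine ⟨ε / C, by positivity, fun c' hc' v hv => ?_⟩
    obtain ⟨a, h1, h2, h3⟩ := hH (v - xs k)
    refine ⟨a, h1, h2, (mul_le_mul_of_nonneg_right hc'.2 (norm_nonneg _)).trans ?_⟩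
    have h0 : 0 ≤ inner ℝ (gradient L xs k) (v - xs k) := by
      have := hN _ (BlockPolyhedron.add_single_mem hxs k hv)
      rw [add_sub_cancel_left, real_inner_comm, inner_single_left, PiLp.neg_apply,
        inner_neg_right, real_inner_comm] at this
      linarith
    have h4 := h3 (inner ℝ (gradient L xs k) (v - xs k) / ε) (by positivity) (by
      intro i hi
      have hi' : inner ℝ (Ω.ω k i) (xs k) = Ω.h k i := hi
      rw [le_div_iff₀ hε, inner_sub_right, hi', abs_sub_comm,
        abs_of_nonneg (sub_nonneg.2 (hv i)), mul_comm]
      exact hslack i hi v hv)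
    rw [div_mul_eq_mul_div, div_le_iff₀ hC]
    calc ε * ‖v - xs k - a‖ ≤ ε * (C * (inner ℝ (gradient L xs k) (v - xs k) / ε)) := by gcongr
      _ = _ := by field_simp)
  refine ⟨B, c, r, fun x hx => hL.contDiffAt (hU.mem_nhds (hΩU hx)), hB, hbd, hxs, hr, hin, hc,
    hsharp, hκ, fun v hv => hsecond v fun w hw => ?_⟩
  -- both `x* + t v` and `x* - t v` are feasible for small `t`, so `v` is normal to the cone
  obtain ⟨t, ht, htv⟩ := exists_pos_norm_smul_lt v hr
  have hmem : ∀ s : ℝ, |s| = t → xs + s • v ∈ Ω.carrier := by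
    intro s hs k i
    by_cases hi : i ∈ Ω.active k (xs k)
    · rw [PiLp.add_apply, PiLp.smul_apply, inner_add_right, inner_smul_right, hv k i hi, mul_zero,
        add_zero]
      exact hxs k i
    · refine (hin k _ ?_ i hi).le
      refine lt_of_le_of_lt ?_ htv
      rw [PiLp.add_apply, PiLp.smul_apply, add_sub_cancel_left, norm_smul, norm_smul,
        Real.norm_eq_abs, hs, Real.norm_of_nonneg ht.le]
      exact mul_le_mul_of_nonneg_left (PiLp.norm_apply_le v k) ht.le
  have h1 := hw _ (hmem t (abs_of_pos ht))
  have h2 := hw _ (hmem (-t) (by rw [abs_neg, abs_of_pos ht]))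
  rw [add_sub_cancel_left, inner_smul_right] at h1 h2
  have h3 : t * inner ℝ w v = 0 := by linarith
  exact (mul_eq_zero.1 h3).resolve_left ht.ne'

end Blocks

/-! ### The Cauchy point -/

section Cauchy

variable {K : ℕ} {n : Fin K → ℕ}

theorem norm_sweepPoint_sub_le (x z : BlockSpace n) (k : Fin K) :
    ‖sweepPoint x z k (x k) - x‖ ≤ ∑ j ∈ Finset.Iio k, ‖z j - x j‖ := by
  refine (PiLp.norm_le_sum_norm _).trans ?_
  rw [← Finset.sum_subset (Finset.subset_univ (Finset.Iio k))]
  · refine Finset.sum_le_sum fun j hj => ?_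
    have hj' : j < k := Finset.mem_Iio.1 hj
    simp [sweepPoint, hj'.ne, hj']
  · intro j _ hj
    have hj' : ¬ j < k := fun h => hj (Finset.mem_Iio.2 h)
    rcases eq_or_ne j k with rfl | hne
    · simp [sweepPoint]
    · simp [sweepPoint, hne, hj']

/-- A discrete Gronwall inequality. -/
theorem exists_gronwall_const (K : ℕ) {a b : ℝ} (ha : 0 ≤ a) (hb : 0 ≤ b) :
    ∃ C, 0 ≤ C ∧ ∀ e : ℝ, 0 ≤ e → ∀ u : Fin K → ℝ,
      (∀ k, u k ≤ a * e + b * ∑ j ∈ Finset.Iio k, u j) → ∀ k, u k ≤ C * e := by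
  have key : ∀ N : ℕ, ∃ C, 0 ≤ C ∧ ∀ e : ℝ, 0 ≤ e → ∀ u : Fin K → ℝ,
      (∀ k, u k ≤ a * e + b * ∑ j ∈ Finset.Iio k, u j) → ∀ k : Fin K, (k : ℕ) < N →
        u k ≤ C * e := by
    intro N
    induction N with
    | zero => exact ⟨0, le_rfl, fun _ _ _ _ _ h => absurd h (Nat.not_lt_zero _)⟩
    | succ N ih =>
      obtain ⟨C, hC, h⟩ := ih
      refine ⟨a + b * (K * C), by positivity, fun e he u hu k hk => (hu k).trans ?_⟩
      have h1 : ∑ j ∈ Finset.Iio k, u j ≤ K * (C * e) := by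
        calc ∑ j ∈ Finset.Iio k, u j ≤ ∑ _j ∈ Finset.Iio k, C * e := Finset.sum_le_sum
              fun j hj => h e he u hu j
                (lt_of_lt_of_le (Fin.lt_def.1 (Finset.mem_Iio.1 hj)) (Nat.lt_succ_iff.1 hk))
          _ = (Finset.Iio k).card * (C * e) := by rw [Finset.sum_const, nsmul_eq_mul]
          _ ≤ K * (C * e) := by
            gcongr
            exact (Finset.card_le_univ _).trans_eq (Fintype.card_fin K)
      nlinarith [mul_le_mul_of_nonneg_left h1 hb]
  obtain ⟨C, hC, h⟩ := key K
  exact ⟨C, hC, fun e he u hu k => h e he u hu k k.2⟩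

theorem model_add {E : Type*} [NormedAddCommGroup E] [InnerProductSpace ℝ E] [CompleteSpace E]
    {L : E → ℝ} {x : E} (h : ContDiffAt ℝ 2 L x) (w u : E) :
    model L x (w + u) = model L x w + inner ℝ (modelGrad L x w) u
      + 1 / 2 * inner ℝ u (hessian L x u) := by
  have h1 : inner ℝ u (hessian L x (w - x)) = inner ℝ (w - x) (hessian L x u) := by
    rw [real_inner_comm, inner_hessian_comm h]
  simp only [model, modelGrad, add_sub_right_comm w u x, map_add, inner_add_left, inner_add_right,
    h1, inner_hessian_comm h (w - x) u]
  ring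

theorem sweepPoint_eq_add_single (x z : BlockSpace n) (k : Fin K)
    (v : EuclideanSpace ℝ (Fin (n k))) :
    sweepPoint x z k v = sweepPoint x z k (x k) + PiLp.single 2 k (v - x k) := by
  ext1 j
  rcases eq_or_ne j k with rfl | hj
  · simp [sweepPoint]
  · simp [sweepPoint, hj]

theorem blockModel_eq {L : BlockSpace n → ℝ} {x : BlockSpace n} (h : ContDiffAt ℝ 2 L x)
    (z : BlockSpace n) (k : Fin K) (v : EuclideanSpace ℝ (Fin (n k))) :
    blockModel L x z k v = blockModel L x z k (x k)
      + inner ℝ (blockModelGrad L x z k) (v - x k)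
      + 1 / 2 * inner ℝ (PiLp.single 2 k (v - x k) : BlockSpace n)
        (hessian L x (PiLp.single 2 k (v - x k))) := by
  rw [blockModel, sweepPoint_eq_add_single, model_add h, real_inner_comm _ (modelGrad L x _),
    inner_single_left, real_inner_comm, blockModel, blockModelGrad]

/-- The changes of the block models add up to the change of the model. -/
theorem model_sub_eq_sum (L : BlockSpace n → ℝ) (x z : BlockSpace n) :
    model L x z - model L x x = ∑ k, (blockModel L x z k (z k) - blockModel L x z k (x k)) := by
  let P : ℕ → BlockSpace n := fun j =>
    WithLp.toLp 2 fun i : Fin K => if (i : ℕ) < j then z i else x i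
  have h1 : ∀ k : Fin K, sweepPoint x z k (x k) = P k := by
    intro k; ext1 j
    rcases eq_or_ne j k with rfl | hj
    · simp [sweepPoint, P]
    · simp [sweepPoint, P, hj]
  have h2 : ∀ k : Fin K, sweepPoint x z k (z k) = P (k + 1) := by
    intro k; ext1 j
    rcases eq_or_ne j k with rfl | hj
    · simp [sweepPoint, P]
    · have : (j : ℕ) ≠ k := fun h => hj (Fin.ext h)
      have h3 : j < k ↔ (j : ℕ) < k + 1 := by rw [Fin.lt_def]; omega
      simp [sweepPoint, P, hj, h3]
  simp only [blockModel, h1, h2]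
  rw [Fin.sum_univ_eq_sum_range (fun k => model L x (P (k + 1)) - model L x (P k)),
    Finset.sum_range_sub (fun k => model L x (P k))]
  have h3 : P K = z := by ext1 j; simp [P]
  have h4 : P 0 = x := by ext1 j; simp [P]
  rw [h3, h4]

theorem IsCauchyPoint.stepsize_le {prm : TrapParams} {Ω : BlockPolyhedron n}
    {L : BlockSpace n → ℝ} {Δ : ℝ} {x z : BlockSpace n} {α : Fin K → ℝ}
    (h : IsCauchyPoint prm Ω L Δ x α z) (k : Fin K) : α k ≤ prm.ν₅ := by
  rcases h.large k with h | ⟨_, _, h, _⟩ <;> exact h.2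

theorem IsCauchyPoint.mem {prm : TrapParams} {Ω : BlockPolyhedron n}
    {L : BlockSpace n → ℝ} {Δ : ℝ} {x z : BlockSpace n} {α : Fin K → ℝ}
    (h : IsCauchyPoint prm Ω L Δ x α z) : z ∈ Ω.carrier := fun k => (h.proj k).1

/-- Cauchy decrease: the upper bound `ν₅` on the step-sizes turns the sufficient decrease conditions
into a bound on the squared step. -/
theorem IsCauchyPoint.sq_norm_le_model_sub {prm : TrapParams} {Ω : BlockPolyhedron n}
    {L : BlockSpace n → ℝ} {Δ : ℝ} {x z : BlockSpace n} {α : Fin K → ℝ}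
    (h : IsCauchyPoint prm Ω L Δ x α z) (hx : x ∈ Ω.carrier) :
    prm.ν₀ / prm.ν₅ * ‖z - x‖ ^ 2 ≤ model L x x - model L x z := by
  have h1 : ∀ k, prm.ν₀ / prm.ν₅ * ‖z k - x k‖ ^ 2
      ≤ -(blockModel L x z k (z k) - blockModel L x z k (x k)) := by
    intro k
    have h2 := (h.proj k).sq_norm_sub_le (Ω.convex_block k) (hx k)
    have h3 : _ ≤ _ := h.decrease k
    have h5 := prm.ν₅_pos
    have h0 := prm.ν₀_mem.1
    have h4 := h.stepsize_le k
    have hαk := h.pos k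
    have h6 : ‖z k - x k‖ ^ 2 ≤ prm.ν₅ * -inner ℝ (blockModelGrad L x z k) (z k - x k) := by
      have : 0 ≤ -inner ℝ (blockModelGrad L x z k) (z k - x k) := by
        by_contra! hneg
        nlinarith [sq_nonneg ‖z k - x k‖]
      nlinarith
    rw [div_mul_eq_mul_div, div_le_iff₀ h5]
    nlinarith [mul_le_mul_of_nonneg_left h6 h0.le]
  have h2 := Finset.sum_le_sum fun k (_ : k ∈ Finset.univ) => h1 k
  rw [Finset.sum_neg_distrib, ← model_sub_eq_sum, ← Finset.mul_sum] at h2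
  have h3 : ‖z - x‖ ^ 2 = ∑ k, ‖z k - x k‖ ^ 2 := by
    rw [PiLp.norm_sq_eq_of_L2]; simp only [PiLp.sub_apply]
  rw [h3]
  linarith

namespace LocalStructure

variable {Ω : BlockPolyhedron n} {L : BlockSpace n → ℝ} {xs : BlockSpace n} {B c r κ : ℝ}

theorem norm_blockModelGrad_sub_le (D : LocalStructure Ω L xs B c r κ) {x : BlockSpace n}
    (hx : x ∈ Ω.carrier) (z : BlockSpace n) (k : Fin K) :
    ‖blockModelGrad L x z k - gradient L xs k‖
      ≤ B * (‖x - xs‖ + ∑ j ∈ Finset.Iio k, ‖z j - x j‖) := by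
  have h1 : blockModelGrad L x z k - gradient L xs k
      = (gradient L x - gradient L xs + hessian L x (sweepPoint x z k (x k) - x)) k := by
    simp only [blockModelGrad, modelGrad, PiLp.add_apply, PiLp.sub_apply]; abel
  rw [h1]
  refine (PiLp.norm_apply_le _ k).trans ((norm_add_le _ _).trans ?_)
  rw [mul_add]
  refine add_le_add (D.norm_gradient_sub_le D.mem hx) ?_
  refine ((hessian L x).le_of_opNorm_le (D.bound x hx) _).trans ?_
  exact mul_le_mul_of_nonneg_left (norm_sweepPoint_sub_le x z k) D.B_pos.le

/-- A sweep of projected gradient steps of bounded length moves a point of `Ω` by at most a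
multiple of its distance to the stationary point `x*`, and perturbs the block gradients by at most
such a multiple. -/
theorem exists_sweep_bound (D : LocalStructure Ω L xs B c r κ) {T : ℝ} (hT : 0 ≤ T) :
    ∃ C, 0 ≤ C ∧ ∀ x ∈ Ω.carrier, ∀ (z : BlockSpace n) (α : Fin K → ℝ),
      (∀ k, α k ∈ Icc 0 T) →
      (∀ k, IsProj (Ω.block k) (x k - α k • blockModelGrad L x z k) (z k)) →
      (∀ k, ‖z k - x k‖ ≤ C * ‖x - xs‖) ∧
      ∀ k, ‖blockModelGrad L x z k - gradient L xs k‖ ≤ C * ‖x - xs‖ := by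
  have hB := D.B_pos
  obtain ⟨C, hC, hG⟩ := exists_gronwall_const K (a := 2 + T * B) (b := T * B) (by positivity)
    (by positivity)
  refine ⟨C + B * (1 + K * C), by positivity, fun x hx z α hα hz => ?_⟩
  have h1 : ∀ k, ‖z k - x k‖ ≤ C * ‖x - xs‖ := by
    refine hG _ (norm_nonneg _) (fun k => ‖z k - x k‖) fun k => ?_
    have h2 := (hz k).norm_sub_le (Ω.convex_block k) (hα k).1 (D.mem k) (D.inner_nonneg k)
    have h3 := D.norm_blockModelGrad_sub_le hx z k
    have h4 : ‖z k - x k‖ ≤ ‖z k - xs k‖ + ‖x k - xs k‖ := by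
      rw [← sub_sub_sub_cancel_right (z k) (x k) (xs k)]; exact norm_sub_le _ _
    have h5 : ‖x k - xs k‖ ≤ ‖x - xs‖ := PiLp.norm_apply_le (x - xs) k
    have h6 := mul_le_mul (hα k).2 h3 (norm_nonneg _) hT
    show ‖z k - x k‖ ≤ _
    linarith
  have hCB : 0 ≤ B * (1 + K * C) * ‖x - xs‖ := by positivity
  refine ⟨fun k => (h1 k).trans (by linarith), fun k => ?_⟩
  refine (D.norm_blockModelGrad_sub_le hx z k).trans ?_
  have h2 : ∑ j ∈ Finset.Iio k, ‖z j - x j‖ ≤ K * (C * ‖x - xs‖) := by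
    calc ∑ j ∈ Finset.Iio k, ‖z j - x j‖ ≤ ∑ _j ∈ Finset.Iio k, C * ‖x - xs‖ :=
          Finset.sum_le_sum fun j _ => h1 j
      _ = (Finset.Iio k).card * (C * ‖x - xs‖) := by rw [Finset.sum_const, nsmul_eq_mul]
      _ ≤ K * (C * ‖x - xs‖) := by
        gcongr
        exact (Finset.card_le_univ _).trans_eq (Fintype.card_fin K)
  have h3 := mul_le_mul_of_nonneg_left h2 hB.le
  have h4 : 0 ≤ C * ‖x - xs‖ := by positivity
  linarith

/-- A projected gradient step that fails the sufficient decrease test is not short. -/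
theorem le_stepsize_of_not_suffDecrease (D : LocalStructure Ω L xs B c r κ) {prm : TrapParams}
    {x z : BlockSpace n} (hx : x ∈ Ω.carrier) {k : Fin K} {t : ℝ} (ht : 0 < t)
    {w : EuclideanSpace ℝ (Fin (n k))}
    (hw : IsProj (Ω.block k) (x k - t • blockModelGrad L x z k) w)
    (h : ¬ SuffDecrease prm L x z k w) : 2 * (1 - prm.ν₀) ≤ t * B := by
  rw [SuffDecrease, blockModel_eq (D.smooth x hx) z k w, not_le] at h
  have h1 := hw.sq_norm_sub_le (Ω.convex_block k) (hx k)
  have h2 := (abs_le.1 (D.abs_inner_hessian_le hx (PiLp.single 2 k (w - x k))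
    (PiLp.single 2 k (w - x k)))).2
  rw [PiLp.norm_single] at h2
  have h0 := prm.ν₀_mem.2
  have h3 : 0 < ‖w - x k‖ ^ 2 := by
    by_contra! hle
    have : 0 ≤ -inner ℝ (blockModelGrad L x z k) (w - x k) := by
      by_contra! hneg
      nlinarith [sq_nonneg ‖w - x k‖]
    have h4 := mul_nonpos_of_nonneg_of_nonpos D.B_pos.le ((sq _).symm.trans_le hle)
    nlinarith [mul_nonneg (sub_nonneg.2 h0.le) this]
  have h4 : (1 - prm.ν₀) * ‖w - x k‖ ^ 2 ≤ t * (B / 2 * ‖w - x k‖ ^ 2) := by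
    have h5 : (1 - prm.ν₀) * -inner ℝ (blockModelGrad L x z k) (w - x k)
        ≤ B / 2 * ‖w - x k‖ ^ 2 := by nlinarith
    nlinarith [mul_le_mul_of_nonneg_left h5 ht.le,
      mul_le_mul_of_nonneg_left h1 (sub_nonneg.2 h0.le)]
  by_contra! hlt
  nlinarith

/-- Identification of the active constraints: near `x*`, the Cauchy point lies on the face of `x*`
unless the trust region is as small as the distance to `x*`. Indeed, if a block of the Cauchy point
misses the face, strict complementarity forces the step-size to be of the order of that distance;
the step-size is then so short that it can only have been caused by the trust region. -/
theorem exists_identification (D : LocalStructure Ω L xs B c r κ) (prm : TrapParams) :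
    ∃ C, 0 ≤ C ∧ ∃ δ > 0, ∀ x ∈ Ω.carrier, ‖x - xs‖ < δ → ∀ (Δ : ℝ) (α : Fin K → ℝ)
      (z : BlockSpace n), IsCauchyPoint prm Ω L Δ x α z →
      ‖z - x‖ ≤ C * ‖x - xs‖ ∧
      ((∀ k, Ω.active k (z k) = Ω.active k (xs k)) ∨ Δ ≤ C * ‖x - xs‖) := by
  have hB := D.B_pos
  have hc := D.c_pos
  have hr := D.r_pos
  have hν₁ := prm.ν₁_pos
  have hν₃ := prm.ν₃_pos
  have hν₄ := prm.ν₄_pos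
  have hν₅ := prm.ν₅_pos
  have hν₀ : 0 < 1 - prm.ν₀ := sub_pos.2 prm.ν₀_mem.2
  obtain ⟨C, hC, hsweep⟩ := D.exists_sweep_bound hν₅.le
  -- `C₁` bounds the move of a projected gradient step of length at most `ν₅ / ν₃`
  set C₁ := 2 + prm.ν₅ / prm.ν₃ * C with hC₁
  have hC₁0 : 0 ≤ C₁ := by positivity
  refine ⟨K * C + C₁ / prm.ν₁, by positivity, ?_⟩
  obtain ⟨δ, hδ, hsmall⟩ : ∃ δ > 0, ∀ e : ℝ, 0 ≤ e → e < δ → C * e < c / 2 ∧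
      (C + 1) * e < r ∧ C * e < c / 2 * prm.ν₄ ∧
      C * e * B < 2 * (1 - prm.ν₀) * prm.ν₃ * (c / 2) := by
    have h1 : ∀ᶠ e : ℝ in 𝓝 0, C * e < c / 2 ∧
      (C + 1) * e < r ∧ C * e < c / 2 * prm.ν₄ ∧
      C * e * B < 2 * (1 - prm.ν₀) * prm.ν₃ * (c / 2) := by
      have h2 : ∀ (f : ℝ → ℝ) (b : ℝ), Continuous f → f 0 = 0 → 0 < b → ∀ᶠ e in 𝓝 0, f e < b :=
        fun f b hf h0 hb => hf.continuousAt.eventually_lt_const (by rwa [h0])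
      refine (h2 (fun e => C * e) _ (by fun_prop) (by simp) (by positivity)).and
        ((h2 (fun e => (C + 1) * e) _ (by fun_prop) (by simp) hr).and
        ((h2 (fun e => C * e) _ (by fun_prop) (by simp) (by positivity)).and
        (h2 (fun e => C * e * B) _ (by fun_prop) (by simp) (by positivity))))
    obtain ⟨δ, hδ, h3⟩ := Metric.eventually_nhds_iff.1 h1
    exact ⟨δ, hδ, fun e he heδ => h3 (by rwa [Real.dist_0_eq_abs, abs_of_nonneg he])⟩
  refine ⟨δ, hδ, fun x hx hxδ Δ α z hz => ?_⟩
  obtain ⟨s1, s2, s3, s4⟩ := hsmall _ (norm_nonneg _) hxδ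
  obtain ⟨hzx, hG⟩ := hsweep x hx z α (fun k => ⟨(hz.pos k).le, hz.stepsize_le k⟩) hz.proj
  have hnn : 0 ≤ ‖x - xs‖ := norm_nonneg _
  refine ⟨?_, ?_⟩
  · calc ‖z - x‖ ≤ ∑ k, ‖z k - x k‖ := PiLp.norm_le_sum_norm (z - x)
      _ ≤ ∑ _k : Fin K, C * ‖x - xs‖ := Finset.sum_le_sum fun k _ => hzx k
      _ = K * C * ‖x - xs‖ := by simp [mul_assoc]
      _ ≤ _ := by
        have : 0 ≤ C₁ / prm.ν₁ * ‖x - xs‖ := by positivity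
        linarith
  refine or_iff_not_imp_left.2 fun hne => ?_
  push Not at hne
  obtain ⟨k, hk⟩ := hne
  have hzs : ‖z k - xs k‖ < r := by
    calc ‖z k - xs k‖ = ‖(z k - x k) + (x - xs) k‖ := by
          rw [PiLp.sub_apply, sub_add_sub_cancel]
      _ ≤ C * ‖x - xs‖ + ‖x - xs‖ :=
          (norm_add_le _ _).trans (add_le_add (hzx k) (PiLp.norm_apply_le _ k))
      _ = (C + 1) * ‖x - xs‖ := by ring
      _ < r := s2
  obtain ⟨a, ha0, ha, hac⟩ := D.sharp k (z k) (hz.proj k).1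
  have hb : z k - xs k - a ≠ 0 := by
    intro h0
    refine hk (Subset.antisymm (D.active_subset hzs) fun i hi => ?_)
    have h1 : z k = xs k + a := by rw [sub_sub, sub_eq_zero] at h0; exact h0
    have h2 : inner ℝ (Ω.ω k i) (xs k) = Ω.h k i := hi
    show inner ℝ (Ω.ω k i) (z k) = Ω.h k i
    rw [h1, inner_add_right, ha0 i hi, h2, add_zero]
  have h1 := (hz.proj k).stepsize_mul_le (Ω.convex_block k) (hz.pos k).le
    (D.add_mem_block (ha.trans_lt hzs) ha0) (D.inner_gradient_eq_zero ha0) hac hb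
  have h2 : α k * (c / 2) ≤ C * ‖x - xs‖ := by
    have h3 := hzx k
    rw [norm_sub_rev] at h3
    have h4 := hG k
    have h5 : c / 2 ≤ c - ‖blockModelGrad L x z k - gradient L xs k‖ := by linarith
    nlinarith [mul_le_mul_of_nonneg_left h5 (hz.pos k).le]
  rcases hz.large k with h3 | ⟨t, ht, h3, w, hw, hor⟩
  · nlinarith [h3.1]
  have htν : t ≤ prm.ν₅ / prm.ν₃ := by
    rw [le_div_iff₀ hν₃, mul_comm]; exact h3.1.trans h3.2
  have hdec : SuffDecrease prm L x z k w := by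
    by_contra hnot
    have h4 := D.le_stepsize_of_not_suffDecrease hx ht hw hnot
    have h5 : prm.ν₃ * t * (c / 2) ≤ C * ‖x - xs‖ :=
      (mul_le_mul_of_nonneg_right h3.1 (by positivity)).trans h2
    have h6 := mul_le_mul_of_nonneg_left h4 (show 0 ≤ prm.ν₃ * (c / 2) by positivity)
    have h7 := mul_le_mul_of_nonneg_right h5 hB.le
    linarith
  have h4 := hor.resolve_left (not_not.2 hdec)
  have h5 : ‖w - x k‖ ≤ C₁ * ‖x - xs‖ := by
    have h6 := hw.norm_sub_le (Ω.convex_block k) ht.le (D.mem k) (D.inner_nonneg k)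
    have h7 : ‖w - x k‖ ≤ ‖w - xs k‖ + ‖x k - xs k‖ := by
      rw [← sub_sub_sub_cancel_right w (x k) (xs k)]; exact norm_sub_le _ _
    have h8 : ‖x k - xs k‖ ≤ ‖x - xs‖ := PiLp.norm_apply_le (x - xs) k
    have h9 := mul_le_mul htν (hG k) (norm_nonneg _) (by positivity)
    rw [hC₁]
    linarith
  have h6 : Δ ≤ C₁ / prm.ν₁ * ‖x - xs‖ := by
    rw [div_mul_eq_mul_div, le_div_iff₀ hν₁, mul_comm]
    exact (h4.trans (blockSupNorm_le_norm _)).trans h5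
  have h7 : 0 ≤ K * C * ‖x - xs‖ := by positivity
  linarith

end LocalStructure

end Cauchy

/-! ### Growth, capture and predicted decrease -/

/-- A sequence along which `f` decreases is captured by a strict minimiser of quadratic growth that
is one of its cluster points, provided that its steps are small close to that minimiser. -/
theorem tendsto_of_mapClusterPt_of_growth {E : Type*} [NormedAddCommGroup E] {S : Set E}
    {f : E → ℝ} {xs : E} {m δ C : ℝ} (hm : 0 < m) (hδ : 0 < δ) (hC : 0 ≤ C)
    (hgrowth : ∀ y ∈ S, ‖y - xs‖ < δ → m * ‖y - xs‖ ^ 2 ≤ f y - f xs)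
    (hf : ContinuousAt f xs) {x : ℕ → E} (hx : ∀ l, x l ∈ S)
    (hanti : ∀ l, f (x (l + 1)) ≤ f (x l))
    (hstep : ∀ l, ‖x l - xs‖ < δ → ‖x (l + 1) - x l‖ ≤ C * ‖x l - xs‖)
    (hcl : MapClusterPt xs atTop x) : Tendsto x atTop (𝓝 xs) := by
  refine Metric.tendsto_atTop.2 fun ε hε => ?_
  set r := min ε (δ / (C + 1)) with hr
  have hr0 : 0 < r := lt_min hε (by positivity)
  have hrδ : (C + 1) * r ≤ δ := by
    have h1 : r ≤ δ / (C + 1) := min_le_right _ _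
    rw [le_div_iff₀ (by positivity)] at h1
    linarith
  have hrδ' : r ≤ δ := by nlinarith
  have hev : ∀ᶠ w in 𝓝 xs, ‖w - xs‖ < r ∧ f w < f xs + m * r ^ 2 := by
    refine Eventually.and ?_ (hf.eventually_lt_const (by
      have : 0 < m * r ^ 2 := by positivity
      linarith))
    filter_upwards [Metric.ball_mem_nhds xs hr0] with w hw
    rwa [mem_ball_iff_norm] at hw
  obtain ⟨N, hN⟩ := (hcl.frequently hev).exists
  refine ⟨N, fun l hl => ?_⟩
  suffices h : ‖x l - xs‖ < r ∧ f (x l) < f xs + m * r ^ 2 by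
    rw [dist_eq_norm]; exact h.1.trans_le (min_le_left _ _)
  induction l, hl using Nat.le_induction with
  | base => exact hN
  | succ l _ ih =>
    have h1 := hstep l (ih.1.trans_le hrδ')
    have h2 : ‖x (l + 1) - xs‖ ≤ ‖x (l + 1) - x l‖ + ‖x l - xs‖ := by
      rw [← sub_add_sub_cancel (x (l + 1)) (x l) xs]; exact norm_add_le _ _
    have h3 : ‖x (l + 1) - xs‖ < δ := by nlinarith [ih.1]
    have h4 := hgrowth _ (hx (l + 1)) h3
    have h5 := hanti l
    refine ⟨?_, h5.trans_lt ih.2⟩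
    refine lt_of_pow_lt_pow_left₀ 2 hr0.le (lt_of_mul_lt_mul_left ?_ hm.le)
    linarith [ih.2]

section Steps

variable {K : ℕ} {n : Fin K → ℕ} {prm : TrapParams} {Ω : BlockPolyhedron n}
  {L : BlockSpace n → ℝ}

theorem BlockPolyhedron.freeSpace_congr {z w : BlockSpace n}
    (h : ∀ k, Ω.active k (z k) = Ω.active k (w k)) : Ω.freeSpace z = Ω.freeSpace w := by
  ext v
  show (∀ k, ∀ i ∈ Ω.active k (z k), _) ↔ ∀ k, ∀ i ∈ Ω.active k (w k), _
  simp only [h]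

theorem BlockPolyhedron.sub_mem_freeSpace {x xs : BlockSpace n}
    (h : ∀ k, Ω.active k (x k) = Ω.active k (xs k)) : x - xs ∈ Ω.freeSpace xs := by
  intro k i hi
  have h1 : inner ℝ (Ω.ω k i) (xs k) = Ω.h k i := hi
  have h2 : inner ℝ (Ω.ω k i) (x k) = Ω.h k i := (h k ▸ hi : i ∈ Ω.active k (x k))
  rw [PiLp.sub_apply, inner_sub_right, h1, h2, sub_self]

theorem regHess_apply (L : BlockSpace n → ℝ) (θ σ : ℝ) (x v : BlockSpace n) :
    regHess L θ σ x v = hessian L x v + (θ * σ) • v := by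
  simp [regHess]

theorem regHess_symm {x : BlockSpace n} (h : ContDiffAt ℝ 2 L x) (θ σ : ℝ) (u v : BlockSpace n) :
    inner ℝ (regHess L θ σ x u) v = inner ℝ u (regHess L θ σ x v) := by
  rw [regHess_apply, regHess_apply, inner_add_left, inner_add_right, inner_hessian_comm h,
    inner_smul_left, inner_smul_right]
  simp

/-- The regularised quadratic differs from the model by the regularisation terms. -/
theorem quadForm_regHess (L : BlockSpace n → ℝ) (θ σ : ℝ) (x z p : BlockSpace n) :
    quadForm (regGrad L σ x z) (regHess L θ σ x) p
      = model L x (x + p) - L x - σ * inner ℝ (z - x) p + θ * σ / 2 * ‖p‖ ^ 2 := by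
  rw [quadForm, regHess_apply, regGrad, model, inner_sub_left, inner_smul_left, inner_add_right,
    inner_smul_right, real_inner_self_eq_norm_sq, add_sub_cancel_left]
  simp only [conj_trivial]
  ring

theorem model_self (L : BlockSpace n → ℝ) (x : BlockSpace n) : model L x x = L x := by
  simp [model]

theorem IsRefinement.descent {θ σ Δ : ℝ} {x z y : BlockSpace n} (hL : ContDiffAt ℝ 2 L x)
    (h : IsRefinement prm Ω L θ σ Δ x z y) :
    (y - x) - (z - x) ∈ Ω.freeSpace z ∧
      quadForm (regGrad L σ x z) (regHess L θ σ x) (y - x)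
        ≤ quadForm (regGrad L σ x z) (regHess L θ σ x) (z - x) :=
  h.scg.descent (Ω.convex_refineSet _ _ _) (regHess_symm hL θ σ)

/-- The model decrease controls the squared step: the Cauchy decrease controls the Cauchy step, and
the proximal term of the refinement phase controls the remaining part. -/
theorem exists_sq_norm_le_model_sub {θ σlow : ℝ} (hθ : θ ∈ Icc (1 / 2 : ℝ) 1) (hσlow : 0 < σlow) :
    ∃ m > 0, ∀ (σ Δ : ℝ) (x z y : BlockSpace n) (α : Fin K → ℝ), σlow ≤ σ → σ ≤ 1 →
      ContDiffAt ℝ 2 L x → x ∈ Ω.carrier → IsCauchyPoint prm Ω L Δ x α z →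
      IsRefinement prm Ω L θ σ Δ x z y →
      m * ‖y - x‖ ^ 2 ≤ model L x x - model L x y := by
  have hγ := prm.γ₁_mem.1
  have hν₀ := prm.ν₀_mem.1
  have hν₅ := prm.ν₅_pos
  set w := prm.γ₁ * (prm.ν₀ / prm.ν₅) with hw
  have hw0 : 0 < w := by positivity
  refine ⟨σlow / 8 / (1 + 2 / w), by positivity, fun σ Δ x z y α h1 h2 hL hx hz hy => ?_⟩
  have h3 := hz.sq_norm_le_model_sub hx
  have h4 := (hy.descent hL).2
  rw [quadForm_regHess, quadForm_regHess, add_sub_cancel, add_sub_cancel,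
    real_inner_self_eq_norm_sq, ← model_self L x] at h4
  have h5 := hy.decrease
  have hM : w * ‖z - x‖ ^ 2 ≤ model L x x - model L x y :=
    le_trans (by rw [hw, mul_assoc]; exact mul_le_mul_of_nonneg_left h3 hγ.le) h5
  have h6 := real_inner_le_norm (z - x) (y - x)
  have hσ : 0 < σ := hσlow.trans_le h1
  have h0 : 0 ≤ prm.ν₀ / prm.ν₅ * ‖z - x‖ ^ 2 := by positivity
  have h7 : σlow / 8 * ‖y - x‖ ^ 2
      ≤ (model L x x - model L x y) + 2 * ‖z - x‖ ^ 2 := by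
    -- Young's inequality `|s| |p| ≤ |p|² / 8 + 2 |s|²` for `s = z - x` and `p = y - x`
    have h8 : ‖z - x‖ * ‖y - x‖ ≤ ‖y - x‖ ^ 2 / 8 + 2 * ‖z - x‖ ^ 2 := by
      nlinarith [sq_nonneg (‖y - x‖ - 4 * ‖z - x‖)]
    have h9 := mul_le_mul_of_nonneg_left (h6.trans h8) hσ.le
    have h10 : 1 / 4 * σ * ‖y - x‖ ^ 2 ≤ θ * σ / 2 * ‖y - x‖ ^ 2 :=
      mul_le_mul_of_nonneg_right (by nlinarith [hθ.1]) (sq_nonneg _)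
    have h11 : θ * σ / 2 * ‖z - x‖ ^ 2 ≤ σ * ‖z - x‖ ^ 2 :=
      mul_le_mul_of_nonneg_right (by nlinarith [hθ.2]) (sq_nonneg _)
    have h12 : σlow / 8 * ‖y - x‖ ^ 2 ≤ σ / 8 * ‖y - x‖ ^ 2 := by gcongr
    have h13 : σ * ‖z - x‖ ^ 2 ≤ 1 * ‖z - x‖ ^ 2 := by gcongr
    linarith
  rw [div_mul_eq_mul_div, div_le_iff₀ (by positivity)]
  have h8 : 2 * ‖z - x‖ ^ 2 ≤ (model L x x - model L x y) * (2 / w) := by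
    rw [mul_div_assoc', le_div_iff₀ hw0]; linarith
  linarith

/-- A point that is its own Cauchy point is critical. -/
theorem IsCauchyPoint.isProj_of_eq {Δ : ℝ} {x : BlockSpace n} {α : Fin K → ℝ}
    (h : IsCauchyPoint prm Ω L Δ x α x) : IsProj Ω.carrier (x - gradient L x) x := by
  refine isProj_of_inner_le_zero h.mem fun w hw => ?_
  rw [PiLp.inner_apply]
  refine Finset.sum_nonpos fun k _ => ?_
  have h1 := (h.proj k).inner_le_zero (Ω.convex_block k) (hw k)
  have h2 : sweepPoint x x k (x k) = x := by
    ext1 j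
    rcases eq_or_ne j k with rfl | hj
    · simp [sweepPoint]
    · simp [sweepPoint]
  rw [blockModelGrad, h2, modelGrad, sub_self, map_zero, add_zero, sub_right_comm, sub_self,
    zero_sub, inner_neg_left, inner_smul_left, conj_trivial] at h1
  rw [PiLp.sub_apply, PiLp.sub_apply, PiLp.sub_apply, sub_right_comm, sub_self, zero_sub,
    inner_neg_left, neg_nonpos]
  have h3 := h.pos k
  by_contra! hneg
  nlinarith

namespace LocalStructure

variable {xs : BlockSpace n} {B c r κ : ℝ}

/-- Quadratic growth of `L` on `Ω` at `x*`: linear growth away from the face of `x*`, and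
coercivity of the Hessian along it. -/
theorem exists_growth (D : LocalStructure Ω L xs B c r κ) :
    ∃ δ > 0, ∀ y ∈ Ω.carrier, ‖y - xs‖ < δ → κ / 8 * ‖y - xs‖ ^ 2 ≤ L y - L xs := by
  have hB := D.B_pos
  have hc := D.c_pos
  have hκ := D.κ_pos
  obtain ⟨δ, hδ, hexp⟩ := exists_uniform_expansion Ω.convex_carrier D.smooth D.mem
    (ε := κ / 16) (by positivity)
  refine ⟨min δ (c / (2 * B + κ)), lt_min hδ (by positivity), fun y hy hyδ => ?_⟩
  have h1 := (hexp xs D.mem (by simpa using hδ)).2 y hy (hyδ.trans_le (min_le_left _ _))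
  have hd : ‖y - xs‖ * (2 * B + κ) ≤ c :=
    (le_div_iff₀ (by positivity)).1 (hyδ.le.trans (min_le_right _ _))
  choose a ha0 had hac using fun k => D.sharp k (y k) (hy k)
  let a' : BlockSpace n := WithLp.toLp 2 a
  have ha' : a' ∈ Ω.freeSpace xs := ha0
  have h2 : ‖a'‖ ≤ ‖y - xs‖ := by
    refine (sq_le_sq₀ (norm_nonneg _) (norm_nonneg _)).1 ?_
    rw [PiLp.norm_sq_eq_of_L2, PiLp.norm_sq_eq_of_L2]
    exact Finset.sum_le_sum fun k _ => by gcongr; exact had k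
  have h3 : c * ‖y - xs - a'‖ ≤ inner ℝ (gradient L xs) (y - xs) := by
    rw [PiLp.inner_apply]
    calc c * ‖y - xs - a'‖ ≤ c * ∑ k, ‖y k - xs k - a k‖ :=
          mul_le_mul_of_nonneg_left (PiLp.norm_le_sum_norm _) hc.le
      _ = ∑ k, c * ‖y k - xs k - a k‖ := Finset.mul_sum _ _ _
      _ ≤ _ := Finset.sum_le_sum fun k _ => hac k
  set d := y - xs with hd'
  set b := d - a' with hb
  have hdab : d = a' + b := by rw [hb]; abel
  have hbd : ‖b‖ ≤ 2 * ‖d‖ := (norm_sub_le _ _).trans (by linarith)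
  have h4 := D.coercive a' ha'
  have h5 := (abs_le.1 (D.abs_inner_hessian_le D.mem a' b)).1
  have h6 := (abs_le.1 (D.abs_inner_hessian_le D.mem b b)).1
  have h7 : inner ℝ d (hessian L xs d) = inner ℝ a' (hessian L xs a')
      + 2 * inner ℝ a' (hessian L xs b) + inner ℝ b (hessian L xs b) := by
    rw [hdab, map_add, inner_add_left, inner_add_right, inner_add_right,
      ← inner_hessian_comm (D.smooth xs D.mem) b a', real_inner_comm a']
    ring
  have h8 : κ * ‖a'‖ ^ 2 - 4 * B * (‖d‖ * ‖b‖) ≤ inner ℝ d (hessian L xs d) := by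
    have h9 : ‖a'‖ * ‖b‖ ≤ ‖d‖ * ‖b‖ := by gcongr
    have h10 : ‖b‖ * ‖b‖ ≤ 2 * ‖d‖ * ‖b‖ := by gcongr
    nlinarith [mul_le_mul_of_nonneg_left h9 hB.le, mul_le_mul_of_nonneg_left h10 hB.le]
  have h11 : ‖d‖ ^ 2 ≤ 2 * ‖a'‖ ^ 2 + 4 * (‖d‖ * ‖b‖) := by
    have h12 : ‖d‖ ≤ ‖a'‖ + ‖b‖ := by rw [hdab]; exact norm_add_le _ _
    have h13 : ‖b‖ * ‖b‖ ≤ 2 * ‖d‖ * ‖b‖ := by gcongr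
    nlinarith [sq_nonneg (‖a'‖ - ‖b‖), norm_nonneg d]
  have h14 := (abs_le.1 h1.2).1
  simp only [model] at h14
  have h15 := mul_le_mul_of_nonneg_left h11 hκ.le
  have h16 := mul_le_mul_of_nonneg_right hd (norm_nonneg b)
  rw [← hd'] at h14
  nlinarith

/-- Near `x*` the refined step is at most a multiple of the distance to `x*`. If the Cauchy point
lies on the face of `x*`, the regularised quadratic is strongly convex on the search space and has a
small gradient at the Cauchy point; otherwise the trust region is small. -/
theorem exists_step_bound (D : LocalStructure Ω L xs B c r κ) (prm : TrapParams) {θ : ℝ}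
    (hθ : θ ∈ Icc (1 / 2 : ℝ) 1) :
    ∃ C, 0 ≤ C ∧ ∃ δ > 0, ∀ x ∈ Ω.carrier, ‖x - xs‖ < δ → ∀ (Δ σ : ℝ) (α : Fin K → ℝ)
      (z y : BlockSpace n), 0 ≤ σ → σ ≤ 1 → IsCauchyPoint prm Ω L Δ x α z →
      IsRefinement prm Ω L θ σ Δ x z y →
      ‖z - x‖ ≤ C * ‖x - xs‖ ∧ ‖y - x‖ ≤ C * ‖x - xs‖ ∧
      ((∀ k, Ω.active k (z k) = Ω.active k (xs k)) ∨ Δ ≤ C * ‖x - xs‖) := by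
  have hB := D.B_pos
  have hκ := D.κ_pos
  have hγ := prm.γ₂_pos
  obtain ⟨C, hC, δ₁, hδ₁, hid⟩ := D.exists_identification prm
  obtain ⟨δ₂, hδ₂, hexp⟩ := exists_uniform_expansion Ω.convex_carrier D.smooth D.mem
    (ε := κ / 2) (by positivity)
  set C₁ := (B + (B + 2) * C) / (κ / 4) with hC₁
  set C₂ := (∑ k, (n k : ℝ)) * (prm.γ₂ * C) with hC₂
  have hC₁0 : 0 ≤ C₁ := by positivity
  have hC₂0 : 0 ≤ C₂ := by positivity
  refine ⟨C + C₁ + C₂, by positivity, min δ₁ δ₂, lt_min hδ₁ hδ₂,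
    fun x hx hxδ Δ σ α z y hσ0 hσ1 hz hy => ?_⟩
  obtain ⟨hs, hor⟩ := hid x hx (hxδ.trans_le (min_le_left _ _)) Δ α z hz
  have he : 0 ≤ ‖x - xs‖ := norm_nonneg _
  have hCe : 0 ≤ C * ‖x - xs‖ := by positivity
  have hC₁e : 0 ≤ C₁ * ‖x - xs‖ := by positivity
  have hC₂e : 0 ≤ C₂ * ‖x - xs‖ := by positivity
  refine ⟨by linarith, ?_, hor.imp_right fun h => by linarith⟩
  rcases hor with hact | hΔ
  · have hH := (hexp x hx (hxδ.trans_le (min_le_right _ _))).1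
    obtain ⟨hv, hq⟩ := hy.descent (D.smooth x hx)
    rw [BlockPolyhedron.freeSpace_congr hact] at hv
    set s := z - x with hs'
    set v := (y - x) - s with hv'
    set c₀ := regGrad L σ x z + regHess L θ σ x s with hc₀
    rw [show y - x = s + v by rw [hv']; abel, quadForm_add (regHess_symm (D.smooth x hx) θ σ),
      ← hc₀] at hq
    have h1 : κ / 2 * ‖v‖ ^ 2 ≤ inner ℝ v (regHess L θ σ x v) := by
      have h2 := D.coercive v hv
      have h3 : |inner ℝ v ((hessian L x - hessian L xs) v)| ≤ κ / 2 * ‖v‖ ^ 2 := by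
        refine (abs_real_inner_le_norm _ _).trans ?_
        have := (hessian L x - hessian L xs).le_of_opNorm_le hH v
        nlinarith [norm_nonneg v]
      have h4 := (abs_le.1 h3).1
      rw [sub_apply, inner_sub_right] at h4
      rw [regHess_apply, inner_add_right, inner_smul_right, real_inner_self_eq_norm_sq]
      have h5 : 0 ≤ θ * σ * ‖v‖ ^ 2 := by have := hθ.1; positivity
      linarith
    have h2 : inner ℝ c₀ v = inner ℝ (c₀ - gradient L xs) v := by
      rw [inner_sub_left, D.inner_gradient_freeSpace hv, sub_zero]
    have h3 : ‖c₀ - gradient L xs‖ ≤ (B + (B + 2) * C) * ‖x - xs‖ := by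
      have h4 : c₀ - gradient L xs
          = (gradient L x - gradient L xs) + (-(σ • s) + (hessian L x s + (θ * σ) • s)) := by
        rw [hc₀, regHess_apply, regGrad, ← hs']; abel
      have h5 := D.norm_gradient_sub_le D.mem hx
      have h6 := (hessian L x).le_of_opNorm_le (D.bound x hx) s
      have h7 : ‖-(σ • s)‖ ≤ ‖s‖ := by
        rw [norm_neg, norm_smul, Real.norm_of_nonneg hσ0]
        exact mul_le_of_le_one_left (norm_nonneg _) hσ1
      have h8 : ‖(θ * σ) • s‖ ≤ ‖s‖ := by
        have h9 : 0 ≤ θ := by linarith [hθ.1]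
        rw [norm_smul, Real.norm_of_nonneg (by positivity)]
        exact mul_le_of_le_one_left (norm_nonneg _) (mul_le_one₀ hθ.2 hσ0 hσ1)
      rw [h4]
      have h9 := norm_add_le (gradient L x - gradient L xs)
        (-(σ • s) + (hessian L x s + (θ * σ) • s))
      have h10 := norm_add_le (-(σ • s)) (hessian L x s + (θ * σ) • s)
      have h11 := norm_add_le (hessian L x s) ((θ * σ) • s)
      have h12 := mul_le_mul_of_nonneg_left hs (show 0 ≤ B + 2 by positivity)
      linarith
    have h4 : ‖v‖ ≤ C₁ * ‖x - xs‖ := by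
      rw [hC₁, div_mul_eq_mul_div, le_div_iff₀ (by positivity)]
      refine le_trans ?_ h3
      have h5 := (abs_le.1 (abs_real_inner_le_norm (c₀ - gradient L xs) v)).1
      rcases (norm_nonneg v).eq_or_lt with h0 | h0
      · rw [← h0, zero_mul]; exact norm_nonneg _
      · refine le_of_mul_le_mul_right ?_ h0
        nlinarith
    have h5 : ‖y - x‖ ≤ ‖s‖ + ‖v‖ := by
      rw [show y - x = s + v by rw [hv']; abel]; exact norm_add_le _ _
    linarith
  · have h1 := norm_le_mul_fullSupNorm (y - x)
    have h2 : fullSupNorm (y - x) ≤ prm.γ₂ * (C * ‖x - xs‖) :=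
      hy.inside.trans (mul_le_mul_of_nonneg_left hΔ hγ.le)
    have h3 := mul_le_mul_of_nonneg_left h2
      (show 0 ≤ ∑ k, (n k : ℝ) from Finset.sum_nonneg fun _ _ => Nat.cast_nonneg _)
    have h4 : (∑ k, (n k : ℝ)) * (prm.γ₂ * (C * ‖x - xs‖)) = C₂ * ‖x - xs‖ := by
      rw [hC₂]; ring
    linarith

end LocalStructure

end Steps

/-! ### Local convergence -/

section Convergence

variable {K : ℕ} {n : Fin K → ℕ} {prm : TrapParams} {Ω : BlockPolyhedron n}
  {L : BlockSpace n → ℝ}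

theorem IsRefinement.model_sub_nonneg {θ σ Δ : ℝ} {x z y : BlockSpace n} {α : Fin K → ℝ}
    (hx : x ∈ Ω.carrier) (hz : IsCauchyPoint prm Ω L Δ x α z)
    (hy : IsRefinement prm Ω L θ σ Δ x z y) : 0 ≤ model L x x - model L x y := by
  have h1 := hz.sq_norm_le_model_sub hx
  have h2 : 0 ≤ prm.ν₀ / prm.ν₅ * ‖z - x‖ ^ 2 := by
    have := prm.ν₀_mem.1
    have := prm.ν₅_pos
    positivity
  exact (mul_nonneg prm.γ₁_mem.1.le (h2.trans h1)).trans hy.decrease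

/-- The model decreases strictly at a noncritical point. -/
theorem IsRefinement.model_sub_pos {θ σ Δ : ℝ} {x z y : BlockSpace n} {α : Fin K → ℝ}
    (hx : x ∈ Ω.carrier) (hcrit : ¬ IsProj Ω.carrier (x - gradient L x) x)
    (hz : IsCauchyPoint prm Ω L Δ x α z)
    (hy : IsRefinement prm Ω L θ σ Δ x z y) : 0 < model L x x - model L x y := by
  have h1 := hz.sq_norm_le_model_sub hx
  have h2 : 0 < prm.ν₀ / prm.ν₅ * ‖z - x‖ ^ 2 := by
    have := prm.ν₀_mem.1
    have := prm.ν₅_pos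
    have : z - x ≠ 0 := fun h => hcrit (by
      rw [sub_eq_zero.1 h] at hz; exact hz.isProj_of_eq)
    positivity
  exact (mul_pos prm.γ₁_mem.1 (h2.trans_le h1)).trans_le hy.decrease

theorem TrustUpdate.eq_or_eq {x y x' : BlockSpace n} {Δ Δ' : ℝ}
    (h : TrustUpdate prm L x y Δ x' Δ') :
    x' = x ∨ x' = y ∧ prm.η₁ ≤ trustRatio L x y := by
  rcases lt_or_ge (trustRatio L x y) prm.η₁ with h1 | h1
  · exact Or.inl (h.1 h1).1
  · rcases le_or_gt (trustRatio L x y) prm.η₂ with h2 | h2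
    · exact Or.inr ⟨(h.2.1 ⟨h1, h2⟩).1, h1⟩
    · exact Or.inr ⟨(h.2.2 h2).1, h1⟩

theorem TrustUpdate.radius_pos {x y x' : BlockSpace n} {Δ Δ' : ℝ}
    (h : TrustUpdate prm L x y Δ x' Δ') (hΔ : 0 < Δ) : 0 < Δ' := by
  have h0 := mul_pos prm.σ₁_pos hΔ
  rcases lt_or_ge (trustRatio L x y) prm.η₁ with h1 | h1
  · exact h0.trans_le (h.1 h1).2.1
  · rcases le_or_gt (trustRatio L x y) prm.η₂ with h2 | h2
    · exact h0.trans_le (h.2.1 ⟨h1, h2⟩).2.1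
    · exact hΔ.trans_le (h.2.2 h2).2.1

namespace IsTrapRun

variable {θ σlow σbar : ℝ} {x z y : ℕ → BlockSpace n} {α : ℕ → Fin K → ℝ} {Δ σ : ℕ → ℝ}

theorem mem (R : IsTrapRun prm Ω L θ σlow σbar x z y α Δ σ) (l : ℕ) : x l ∈ Ω.carrier := by
  induction l with
  | zero => exact R.start
  | succ l ih =>
    rcases (R.update l).eq_or_eq with h | h
    · rw [h]; exact ih
    · rw [h.1]; exact (R.refinement l).mem

theorem radius_pos (R : IsTrapRun prm Ω L θ σlow σbar x z y α Δ σ) (l : ℕ) : 0 < Δ l := by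
  induction l with
  | zero => exact R.radius
  | succ l ih => exact (R.update l).radius_pos ih

theorem value_succ_le (R : IsTrapRun prm Ω L θ σlow σbar x z y α Δ σ) (l : ℕ) :
    L (x (l + 1)) ≤ L (x l) := by
  rcases (R.update l).eq_or_eq with h | ⟨h, hρ⟩
  · rw [h]
  · rw [h]
    have h1 := (R.refinement l).model_sub_nonneg (R.mem l) (R.cauchy l)
    by_contra! hlt
    have h2 : trustRatio L (x l) (y l) ≤ 0 :=
      div_nonpos_of_nonpos_of_nonneg (by linarith) h1
    linarith [prm.η₁_pos]

theorem norm_succ_sub_le (R : IsTrapRun prm Ω L θ σlow σbar x z y α Δ σ) (l : ℕ) :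
    ‖x (l + 1) - x l‖ ≤ ‖y l - x l‖ := by
  rcases (R.update l).eq_or_eq with h | ⟨h, -⟩
  · rw [h, sub_self, norm_zero]; exact norm_nonneg _
  · rw [h]

variable {xs : BlockSpace n} {B c r κ : ℝ}

/-- A run that clusters at `x*` converges to it. -/
theorem tendsto (R : IsTrapRun prm Ω L θ σlow σbar x z y α Δ σ)
    (D : LocalStructure Ω L xs B c r κ) (hθ : θ ∈ Icc (1 / 2 : ℝ) 1) (hσlow : 0 < σlow)
    (hσbar : σbar ≤ 1) (hcl : MapClusterPt xs atTop x) : Tendsto x atTop (𝓝 xs) := by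
  obtain ⟨δ₁, hδ₁, hgrowth⟩ := D.exists_growth
  obtain ⟨C, hC, δ₂, hδ₂, hstep⟩ := D.exists_step_bound prm hθ
  refine tendsto_of_mapClusterPt_of_growth (S := Ω.carrier) (f := L) (m := κ / 8)
    (δ := min δ₁ δ₂) (C := C) (by have := D.κ_pos; positivity) (lt_min hδ₁ hδ₂) hC
    (fun y hy hyδ => hgrowth y hy (hyδ.trans_le (min_le_left _ _)))
    (D.smooth xs D.mem).continuousAt R.mem R.value_succ_le (fun l hl => ?_) hcl
  have hσ := R.reg l
  exact (R.norm_succ_sub_le l).trans (hstep _ (R.mem l) (hl.trans_le (min_le_right _ _)) _ _ _ _ _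
    (hσlow.trans hσ.1).le (hσ.2.le.trans hσbar) (R.cauchy l) (R.refinement l)).2.1

/-- Close to its limit `x*`, a run accepts every step and never shrinks the trust region, because
the model decrease dominates the error of the second-order expansion. -/
theorem eventually_accept (R : IsTrapRun prm Ω L θ σlow σbar x z y α Δ σ)
    (D : LocalStructure Ω L xs B c r κ) (hθ : θ ∈ Icc (1 / 2 : ℝ) 1) (hσlow : 0 < σlow)
    (hσbar : σbar ≤ 1) (hx : Tendsto x atTop (𝓝 xs)) (hy : Tendsto y atTop (𝓝 xs)) :
    ∀ᶠ l in atTop, x (l + 1) = y l ∧ Δ l ≤ Δ (l + 1) := by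
  obtain ⟨m, hm, hdec⟩ := exists_sq_norm_le_model_sub (prm := prm) (Ω := Ω) (L := L) hθ hσlow
  have hη : 0 < 1 - prm.η₂ := sub_pos.2 prm.η₂_lt
  obtain ⟨δ, hδ, hexp⟩ := exists_uniform_expansion Ω.convex_carrier D.smooth D.mem
    (ε := (1 - prm.η₂) / 2 * m) (by positivity)
  have hball : {w | ‖w - xs‖ < δ} ∈ 𝓝 xs := by
    filter_upwards [Metric.ball_mem_nhds xs hδ] with w hw
    rwa [mem_ball_iff_norm] at hw
  filter_upwards [hx.eventually_mem hball, hy.eventually_mem hball] with l hxl hyl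
  have hσ := R.reg l
  have h1 := hdec _ _ _ _ _ _ hσ.1.le (hσ.2.le.trans hσbar) (D.smooth _ (R.mem l)) (R.mem l)
    (R.cauchy l) (R.refinement l)
  have h2 := (R.refinement l).model_sub_pos (R.mem l) (R.running l) (R.cauchy l)
  have h3 := (abs_le.1 ((hexp _ (R.mem l) hxl).2 _ (R.refinement l).mem hyl).2).2
  have h4 : prm.η₂ < trustRatio L (x l) (y l) := by
    rw [trustRatio, lt_div_iff₀ h2]
    have h5 := mul_le_mul_of_nonneg_left h1 (show 0 ≤ (1 - prm.η₂) / 2 by positivity)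
    have h6 := mul_pos hη h2
    have h7 := model_self L (x l)
    linarith
  exact ⟨((R.update l).2.2 h4).1, ((R.update l).2.2 h4).2.1⟩

end IsTrapRun

/-- The error of one inexact Newton step on the face of `x*`: every term on the right is the
contribution of one of the perturbations (forcing term, second-order expansion, regularisation). -/
theorem LocalStructure.newton_error {xs : BlockSpace n} {B c r κ : ℝ}
    (D : LocalStructure Ω L xs B c r κ) {θ σ ξ ε : ℝ} (hθ : θ ∈ Icc (1 / 2 : ℝ) 1) (hσ : 0 ≤ σ)
    (hξ : 0 ≤ ξ) {x z y : BlockSpace n} (hx : x ∈ Ω.carrier)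
    (hy : ∀ k, Ω.active k (y k) = Ω.active k (xs k))
    (hH : ‖hessian L x - hessian L xs‖ ≤ ε)
    (hg : ‖gradient L x - gradient L xs - hessian L xs (x - xs)‖ ≤ ε * ‖x - xs‖)
    (hN : ‖(Ω.freeSpace xs).starProjection (regGrad L σ x z + regHess L θ σ x (y - x))‖
      ≤ ξ * ‖(Ω.freeSpace xs).starProjection (gradient L x)‖) :
    κ * ‖y - xs‖ ≤ ξ * (B * ‖x - xs‖) + ε * ‖x - xs‖ + ε * ‖y - x‖ + σ * ‖z - x‖
      + σ * ‖y - x‖ := by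
  set V := Ω.freeSpace xs with hV
  have hyV : y - xs ∈ V := BlockPolyhedron.sub_mem_freeSpace hy
  have hP0 : V.starProjection (gradient L xs) = 0 := by
    rw [Submodule.starProjection_apply_eq_zero_iff, Submodule.mem_orthogonal']
    exact fun v hv => D.inner_gradient_freeSpace hv
  set e := (gradient L x - gradient L xs - hessian L xs (x - xs))
    + (hessian L x - hessian L xs) (y - x) - σ • (z - x) + (θ * σ) • (y - x) with he
  have h1 : hessian L xs (y - xs)
      = (regGrad L σ x z + regHess L θ σ x (y - x)) - gradient L xs - e := by
    rw [he, regGrad, regHess_apply, sub_apply,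
      show y - xs = (x - xs) + (y - x) by abel, map_add]
    abel
  have h2 : ‖e‖ ≤ ε * ‖x - xs‖ + ε * ‖y - x‖ + σ * ‖z - x‖ + σ * ‖y - x‖ := by
    have h3 := (hessian L x - hessian L xs).le_of_opNorm_le hH (y - x)
    have h4 : ‖σ • (z - x)‖ = σ * ‖z - x‖ := by rw [norm_smul, Real.norm_of_nonneg hσ]
    have h5 : ‖(θ * σ) • (y - x)‖ ≤ σ * ‖y - x‖ := by
      have h9 : 0 ≤ θ := by linarith [hθ.1]
      rw [norm_smul, Real.norm_of_nonneg (by positivity)]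
      exact mul_le_mul_of_nonneg_right (mul_le_of_le_one_left hσ hθ.2) (norm_nonneg _)
    rw [he]
    refine (norm_add_le _ _).trans (add_le_add ((norm_sub_le _ _).trans (add_le_add
      ((norm_add_le _ _).trans (add_le_add hg h3)) h4.le)) h5)
  have h3 : ‖V.starProjection (gradient L x)‖ ≤ B * ‖x - xs‖ := by
    have : V.starProjection (gradient L x) = V.starProjection (gradient L x - gradient L xs) := by
      rw [map_sub, hP0, sub_zero]
    rw [this]
    exact (V.norm_starProjection_apply_le _).trans (D.norm_gradient_sub_le D.mem hx)
  have h4 : ‖V.starProjection (hessian L xs (y - xs))‖ ≤ ξ * (B * ‖x - xs‖) + ‖e‖ := by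
    rw [h1, map_sub, map_sub, hP0, sub_zero]
    refine (norm_sub_le _ _).trans (add_le_add ?_ (V.norm_starProjection_apply_le _))
    exact hN.trans (mul_le_mul_of_nonneg_left h3 hξ)
  have h5 : κ * ‖y - xs‖ ≤ ‖V.starProjection (hessian L xs (y - xs))‖ := by
    have h6 := D.coercive _ hyV
    have h7 : inner ℝ (y - xs) (hessian L xs (y - xs))
        = inner ℝ (y - xs) (V.starProjection (hessian L xs (y - xs))) := by
      rw [← Submodule.inner_starProjection_left_eq_right,
        Submodule.starProjection_eq_self_iff.2 hyV]
    rw [h7] at h6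
    have h8 := real_inner_le_norm (y - xs) (V.starProjection (hessian L xs (y - xs)))
    rcases (norm_nonneg (y - xs)).eq_or_lt with h0 | h0
    · rw [← h0, mul_zero]; exact norm_nonneg _
    · refine le_of_mul_le_mul_right ?_ h0
      nlinarith
  linarith

/-- Any prescribed linear rate is attained when the regularisation coefficients and the forcing
terms are small enough. -/
theorem LocalStructure.exists_qLinearRate {xs : BlockSpace n} {B c r κ : ℝ}
    (D : LocalStructure Ω L xs B c r κ) (prm : TrapParams) {γstar : ℝ} (hγ : 0 < γstar) {θ : ℝ}
    (hθ : θ ∈ Icc (1 / 2 : ℝ) 1) {ϱ : ℝ} (hϱ : ϱ ∈ Ioo (0 : ℝ) 1) :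
    ∃ σ₀ : ℝ, 0 < σ₀ ∧ ∃ ξ₀ ∈ Ioo (0 : ℝ) 1, ∀ σbar ∈ Ioo 0 σ₀, ∀ σlow ∈ Ioo 0 σbar,
      ∀ (x z y : ℕ → BlockSpace n) (α : ℕ → Fin K → ℝ) (Δ σ ξ : ℕ → ℝ),
        IsTrapRun prm Ω L θ σlow σbar x z y α Δ σ → MapClusterPt xs atTop x →
        InexactNewton Ω L θ γstar x z y Δ σ ξ → limsup ξ atTop < ξ₀ →
        QLinearRate x xs ϱ := by
  have hB := D.B_pos
  have hκ := D.κ_pos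
  have hϱ0 := hϱ.1
  obtain ⟨C, hC, δ₁, hδ₁, hstep⟩ := D.exists_step_bound prm hθ
  -- the error of a step is at most `(ξ B + ε (1 + C) + 2 σ C) / κ` times the distance to `x*`;
  -- each of the three terms is given a third of `ϱ`
  set ε := ϱ * κ / (3 * (1 + C)) with hε
  have hε0 : 0 < ε := by positivity
  obtain ⟨δ₂, hδ₂, hexp⟩ := exists_uniform_expansion Ω.convex_carrier D.smooth D.mem hε0
  refine ⟨min 1 (ϱ * κ / (6 * (1 + C))), lt_min one_pos (by positivity),
    min (1 / 2) (ϱ * κ / (3 * B)), ⟨lt_min (by norm_num) (by positivity),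
      (min_le_left _ _).trans_lt (by norm_num)⟩,
    fun σbar hσbar σlow hσlow x z y α Δ σ ξ R hcl hN hξ => ?_⟩
  have hσ1 : σbar ≤ 1 := hσbar.2.le.trans (min_le_left _ _)
  have hx : Tendsto x atTop (𝓝 xs) := R.tendsto D hθ hσlow.1 hσ1 hcl
  refine ⟨hx, ?_⟩
  have hball : ∀ {w : ℕ → BlockSpace n}, Tendsto w atTop (𝓝 xs) → ∀ {δ : ℝ}, 0 < δ →
      ∀ᶠ l in atTop, ‖w l - xs‖ < δ := fun hw δ hδ => by
    simpa only [dist_eq_norm] using Metric.tendsto_nhds.1 hw δ hδ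
  have hσpos : ∀ l, 0 ≤ σ l := fun l => (hσlow.1.trans (R.reg l).1).le
  have hσle : ∀ l, σ l ≤ 1 := fun l => (R.reg l).2.le.trans hσ1
  have hst : ∀ᶠ l in atTop, ‖z l - x l‖ ≤ C * ‖x l - xs‖ ∧ ‖y l - x l‖ ≤ C * ‖x l - xs‖ ∧
      ((∀ k, Ω.active k (z l k) = Ω.active k (xs k)) ∨ Δ l ≤ C * ‖x l - xs‖) := by
    filter_upwards [hball hx hδ₁] with l hl
    exact hstep _ (R.mem l) hl _ _ _ _ _ (hσpos l) (hσle l) (R.cauchy l) (R.refinement l)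
  have he0 : Tendsto (fun l => ‖x l - xs‖) atTop (𝓝 0) := tendsto_iff_norm_sub_tendsto_zero.1 hx
  have hCe0 : Tendsto (fun l => C * ‖x l - xs‖) atTop (𝓝 0) := by
    simpa using he0.const_mul C
  have hyx : Tendsto (fun l => y l - x l) atTop (𝓝 0) :=
    squeeze_zero_norm' (hst.mono fun l h => h.2.1) hCe0
  have hy : Tendsto y atTop (𝓝 xs) := by simpa using hyx.add hx
  have hacc := R.eventually_accept D hθ hσlow.1 hσ1 hx hy
  -- the trust region radius is bounded away from zero
  obtain ⟨Δmin, hΔmin, hΔ⟩ : ∃ d > 0, ∀ᶠ l in atTop, d ≤ Δ l := by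
    obtain ⟨N, hN⟩ := eventually_atTop.1 hacc
    refine ⟨Δ N, R.radius_pos N, eventually_atTop.2 ⟨N, fun l hl => ?_⟩⟩
    induction l, hl using Nat.le_induction with
    | base => exact le_rfl
    | succ l hl ih => exact ih.trans (hN l hl).2
  have hzact : ∀ᶠ l in atTop, ∀ k, Ω.active k (z l k) = Ω.active k (xs k) := by
    filter_upwards [hst, hΔ, hCe0.eventually_lt_const hΔmin] with l h1 h2 h3
    exact h1.2.2.resolve_right (by linarith)
  have hyact : ∀ᶠ l in atTop, ∀ k, Ω.active k (y l k) = Ω.active k (xs k) := by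
    filter_upwards [hzact, hball hy D.r_pos] with l h1 h2 k
    refine Subset.antisymm (D.active_subset ((PiLp.norm_apply_le (y l - xs) k).trans_lt h2)) ?_
    rw [← h1 k]
    exact (R.refinement l).active k
  have hxact : ∀ᶠ l in atTop, ∀ k, Ω.active k (x l k) = Ω.active k (xs k) := by
    rw [← map_add_atTop_eq_nat 1, eventually_map]
    filter_upwards [hyact, hacc] with l h1 h2
    rw [h2.1]; exact h1
  have hsmall : ∀ᶠ l in atTop, fullSupNorm (y l - x l) ≤ γstar * Δ l := by
    filter_upwards [hΔ, hst, hCe0.eventually_lt_const (mul_pos hγ hΔmin)] with l h1 h2 h3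
    exact (fullSupNorm_le_norm _).trans ((h2.2.1.trans h3.le).trans
      (mul_le_mul_of_nonneg_left h1 hγ.le))
  have hξ' : ∀ᶠ l in atTop, ξ l < min (1 / 2) (ϱ * κ / (3 * B)) :=
    eventually_lt_of_limsup_lt hξ
      (isBoundedUnder_of ⟨1, fun l => (hN l).1.2.le⟩)
  filter_upwards [hst, hacc, hzact, hyact, hxact, hsmall, hξ', hball hx hδ₂] with
    l h1 h2 h3 h4 h5 h6 h7 h8
  have h9 := (hN l).2 h6 fun k => (h5 k).trans (h4 k).symm
  simp only [BlockPolyhedron.freeSpace_congr h3] at h9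
  have h10 := ((hexp xs D.mem (by simpa using hδ₂)).2 _ (R.mem l) h8).1
  have h11 := D.newton_error hθ (hσpos l) (hN l).1.1.le (R.mem l) h4
    (hexp _ (R.mem l) h8).1 h10 h9
  rw [h2.1]
  have hnn : 0 ≤ ‖x l - xs‖ := norm_nonneg _
  have hσC : σ l * (6 * (1 + C)) ≤ ϱ * κ := by
    rw [← le_div_iff₀ (by positivity)]
    exact ((R.reg l).2.trans (hσbar.2.trans_le (min_le_right _ _))).le
  have hεC : ε * (3 * (1 + C)) = ϱ * κ := by
    rw [hε, div_mul_cancel₀ _ (by positivity)]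
  have hξB : ξ l * (3 * B) ≤ ϱ * κ := by
    rw [← le_div_iff₀ (by positivity)]
    exact h7.le.trans (min_le_right _ _)
  have t1 := mul_le_mul_of_nonneg_left h1.2.1 hε0.le
  have t2 := mul_le_mul_of_nonneg_left h1.1 (hσpos l)
  have t3 := mul_le_mul_of_nonneg_left h1.2.1 (hσpos l)
  have t4 := mul_le_mul_of_nonneg_right hσC hnn
  have t5 := mul_le_mul_of_nonneg_right hξB hnn
  have t6 := mul_nonneg (hσpos l) hnn
  have t7 : ε * (3 * (1 + C)) * ‖x l - xs‖ = ϱ * κ * ‖x l - xs‖ := by rw [hεC]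
  refine le_of_mul_le_mul_left ?_ hκ
  linarith

end Convergence

theorem mainTheorem4 {K : ℕ} (n : Fin K → ℕ) (Ω : BlockPolyhedron n) (L : BlockSpace n → ℝ)
    (hsmooth : ∃ U : Set (BlockSpace n), IsOpen U ∧ Ω.carrier ⊆ U ∧ ContDiffOn ℝ 2 L U)
    (hunif : UniformContinuousOn (gradient L) Ω.carrier)
    (hbound : ∃ Bhat : ℝ, 0 < Bhat ∧ ∀ x ∈ Ω.carrier, ‖hessian L x‖ ≤ Bhat)
    (prm : TrapParams) (γstar : ℝ) (hγstar : γstar ∈ Ioo 0 prm.γ₂)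
    (θ : ℝ) (hθ : θ ∈ Icc (1 / 2 : ℝ) 1)
    (xstar : BlockSpace n) (hnondeg : IsNondegenerate Ω.carrier L xstar)
    (κ : ℝ) (hκ : 0 < κ)
    (hsecond : ∀ v : BlockSpace n,
      (∀ w ∈ normalCone Ω.carrier xstar, inner ℝ w v = 0) →
        κ * ‖v‖ ^ 2 ≤ inner ℝ v (hessian L xstar v)) :
    (∃ σ₀ : ℝ, 0 < σ₀ ∧ ∃ ξ₀ ∈ Ioo (0 : ℝ) 1,
      ∀ σbar ∈ Ioo 0 σ₀, ∀ σlow ∈ Ioo 0 σbar,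
        ∀ (x z y : ℕ → BlockSpace n) (α : ℕ → Fin K → ℝ) (Δ σ ξ : ℕ → ℝ),
          IsTrapRun prm Ω L θ σlow σbar x z y α Δ σ →
          BddBelow (L '' {w | w ∈ Ω.carrier ∧ L w ≤ L (x 0)}) →
          MapClusterPt xstar atTop x →
          InexactNewton Ω L θ γstar x z y Δ σ ξ →
          limsup ξ atTop < ξ₀ →
          ∃ ϱ ∈ Ioo (0 : ℝ) 1, QLinearRate x xstar ϱ) ∧
    (∀ ϱ ∈ Ioo (0 : ℝ) 1, ∃ σ₀ : ℝ, 0 < σ₀ ∧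
      ∀ σbar ∈ Ioo 0 σ₀, ∀ σlow ∈ Ioo 0 σbar,
        ∀ (x z y : ℕ → BlockSpace n) (α : ℕ → Fin K → ℝ) (Δ σ ξ : ℕ → ℝ),
          IsTrapRun prm Ω L θ σlow σbar x z y α Δ σ →
          BddBelow (L '' {w | w ∈ Ω.carrier ∧ L w ≤ L (x 0)}) →
          MapClusterPt xstar atTop x →
          InexactNewton Ω L θ γstar x z y Δ σ ξ →
          limsup ξ atTop = 0 →
          QLinearRate x xstar ϱ) := by
  obtain ⟨B, c, r, D⟩ := exists_localStructure hsmooth hbound hnondeg hκ hsecond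
  constructor
  · obtain ⟨σ₀, hσ₀, ξ₀, hξ₀, h⟩ :=
      D.exists_qLinearRate prm hγstar.1 hθ (ϱ := 1 / 2) (by norm_num)
    exact ⟨σ₀, hσ₀, ξ₀, hξ₀, fun σbar h1 σlow h2 x z y α Δ σ ξ R _ hcl hN hξ =>
      ⟨1 / 2, by norm_num, h σbar h1 σlow h2 x z y α Δ σ ξ R hcl hN hξ⟩⟩
  · intro ϱ hϱ
    obtain ⟨σ₀, hσ₀, ξ₀, hξ₀, h⟩ := D.exists_qLinearRate prm hγstar.1 hθ hϱ
    exact ⟨σ₀, hσ₀, fun σbar h1 σlow h2 x z y α Δ σ ξ R _ hcl hN hξ =>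
      h σbar h1 σlow h2 x z y α Δ σ ξ R hcl hN (hξ.trans_lt hξ₀.1)⟩
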